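/- Let $0<q<1$, $\nu>-1$, $\mathbb{R}_q=\{q^n:n\in\mathbb{Z}\}$, and consider real- or complex-valued functions on $\mathbb{R}_q$. Put $\int_0^\infty f(t)\,d_qt=(1-q)\sum_{n\in\mathbb{Z}}q^nf(q^n)$, and let $\mathcal{L}_{q,p,\nu}$ be the space of functions $f$ on $\mathbb{R}_q$ with $\|f\|_{q,p,\nu}=\big(\int_0^\infty|f(x)|^px^{2\nu+1}d_qx\big)^{1/p}<\infty$. Let $$\Delta_{q,\nu}f(x)=\frac{1}{x^2}\big[f(q^{-1}x)-(1+q^{2\nu})f(x)+q^{2\nu}f(qx)\big],$$ $$j_\nu(x,q^2)=\sum_{n\ge0}(-1)^n\frac{q^{n(n+1)}}{(q^{2\nu+2};q^2)_n(q^2;q^2)_n}x^{2n},\qquad c_{q,\nu}=\frac{1}{1-q}\,\frac{(q^{2\nu+2};q^2)_\infty}{(q^2;q^2)_\infty},$$ where $(a;q)_n=\prod_{k=0}^{n-1}(1-aq^k)$ and $(a;q)_\infty=\prod_{k=0}^{\infty}(1-aq^k)$. Let $\mathcal{F}_{q,\nu}f(x)=c_{q,\nu}\int_0^\infty f(t)j_\nu(xt,q^2)t^{2\nu+1}d_qt$,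 $f*_qg=\mathcal{F}_{q,\nu}[\mathcal{F}_{q,\nu}f\cdot\mathcal{F}_{q,\nu}g]$ and $\rho_t=\mathcal{F}_{q,\nu}[z\mapsto e^{-tz^2}]$. For $t\ge0$ and $x,y\in\mathbb{R}_q$ let $$P_x(y,t)=c_{q,\nu}^2\int_0^\infty e^{-tz^2}j_\nu(xz,q^2)j_\nu(yz,q^2)z^{2\nu+1}d_qz,\qquad P_tf(x)=\int_0^\infty P_x(y,t)f(y)y^{2\nu+1}d_qy .$$ (1) Let $1\le p<\infty$ and $f\in\mathcal{L}_{q,p,\nu}$. Then the series defining $P_x(y,t)$ and $P_tf(x)$ converge absolutely for all $t\ge0$ and $x,y\in\mathbb{R}_q$; for $t>0$ the series defining $\rho_t$ and $\rho_t*_qf$ on $\mathbb{R}_q$ also converge absolutely, and $P_tf=\rho_t*_qf$ on $\mathbb{R}_q$. The function $u(t,x)=P_tf(x)$ satisfies $\partial_tu(t,x)=\Delta_{q,\nu}u(t,x)$ for all $t\ge0$ and $x\in\mathbb{R}_q$ (with the one-sided derivative at $t=0$) and $u(0,x)=f(x)$ for all $x\in\mathbb{R}_q$. (2) Let $f\in\mathcal{L}_{q,2,\nu}$,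 and consider the solutions $u$ of this initial value problem on $[0,\infty)\times\mathbb{R}_q$ for which $t\mapsto u(t,\cdot)$ is a continuous map from $[0,\infty)$ to $\mathcal{L}_{q,2,\nu}$ and $u$ is bounded on $[a,b]\times\mathbb{R}_q$ for all $0<a\le b<\infty$. Then $u(t,x)=P_tf(x)$ is such a solution, and it is the only one if and only if $\nu\ge0$. -/

import Mathlib

open Filter Topology

namespace QBessel

noncomputable section

/-- The set `ℝ_q = {q ^ n : n ∈ ℤ}`. A function on `ℝ_q` is represented by a function on `ℝ`, of
which only the values on `ℝ_q` are ever used. -/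
def Rq (q : ℝ) : Set ℝ := Set.range fun n : ℤ => q ^ n

/-- The finite `q`-shifted factorial `(a; q)_n`. -/
def qPoch (a q : ℝ) (n : ℕ) : ℝ := ∏ k ∈ Finset.range n, (1 - a * q ^ k)

/-- The infinite `q`-shifted factorial `(a; q)_∞`. -/
def qPochInf (a q : ℝ) : ℝ := ∏' k : ℕ, (1 - a * q ^ k)

/-- The normalized `q`-Bessel function `j_ν(x, q²)`. -/
def besselJ (q ν x : ℝ) : ℝ :=
  ∑' n : ℕ, (-1) ^ n * (q ^ (n * (n + 1)) /
    (qPoch (q ^ (2 * ν + 2)) (q ^ 2) n * qPoch (q ^ 2) (q ^ 2) n)) * x ^ (2 * n)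

/-- The constant `c_{q,ν}`. -/
def cConst (q ν : ℝ) : ℝ :=
  1 / (1 - q) * (qPochInf (q ^ (2 * ν + 2)) (q ^ 2) / qPochInf (q ^ 2) (q ^ 2))

section Operators

variable {E : Type*} [NormedAddCommGroup E] [NormedSpace ℝ E]

/-- Convergence of the `q`-Jackson integral of `f` over `(0, ∞)`. -/
def JacksonIntegrable (q : ℝ) (f : ℝ → E) : Prop :=
  Summable fun n : ℤ => (q ^ n) • f (q ^ n)

/-- The `q`-Jackson integral `∫₀^∞ f(t) d_q t = (1 - q) ∑_{n ∈ ℤ} q ^ n f(q ^ n)`. -/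
def jackson (q : ℝ) (f : ℝ → E) : E :=
  (1 - q) • ∑' n : ℤ, (q ^ n) • f (q ^ n)

/-- The `q`-Bessel operator `Δ_{q,ν}`. -/
def qLaplacian (q ν : ℝ) (f : ℝ → E) (x : ℝ) : E :=
  (1 / x ^ 2) • (f (q⁻¹ * x) - (1 + q ^ (2 * ν)) • f x + q ^ (2 * ν) • f (q * x))

/-- Membership in the space `𝓛_{q,p,ν}` (`0 < p < ∞`). -/
def MemL (q p ν : ℝ) (f : ℝ → E) : Prop :=
  JacksonIntegrable q fun x => ‖f x‖ ^ p * x ^ (2 * ν + 1)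

/-- The norm of `𝓛_{q,p,ν}`. -/
def normL (q p ν : ℝ) (f : ℝ → E) : ℝ :=
  (jackson q fun x => ‖f x‖ ^ p * x ^ (2 * ν + 1)) ^ (1 / p)

/-- The integrand `t ↦ f(t) j_ν(x t, q²) t ^ (2 ν + 1)` of the `q`-Bessel Fourier transform. -/
def fourierIntegrand (q ν : ℝ) (f : ℝ → E) (x t : ℝ) : E :=
  (besselJ q ν (x * t) * t ^ (2 * ν + 1)) • f t

/-- The `q`-Bessel Fourier transform `𝓕_{q,ν}`. -/
def fourier (q ν : ℝ) (f : ℝ → E) (x : ℝ) : E :=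
  cConst q ν • jackson q (fourierIntegrand q ν f x)

/-- All the series that define `𝓕_{q,ν} f` on `ℝ_q` converge. -/
def FourierDefined (q ν : ℝ) (f : ℝ → E) : Prop :=
  ∀ x ∈ Rq q, JacksonIntegrable q (fourierIntegrand q ν f x)

/-- The integrand of the kernel `heatKernel`. -/
def heatKernelIntegrand (q ν t x y z : ℝ) : ℝ :=
  Real.exp (-t * z ^ 2) * besselJ q ν (x * z) * besselJ q ν (y * z) * z ^ (2 * ν + 1)

/-- The transition kernel
`c_{q,ν}² ∫₀^∞ e^{-t z²} j_ν(x z, q²) j_ν(y z, q²) z ^ (2 ν + 1) d_q z`. -/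
def heatKernel (q ν t x y : ℝ) : ℝ :=
  cConst q ν ^ 2 * jackson q (heatKernelIntegrand q ν t x y)

/-- The integrand of `heatSemigroup`. -/
def heatSemigroupIntegrand (q ν t : ℝ) (f : ℝ → E) (x y : ℝ) : E :=
  (heatKernel q ν t x y * y ^ (2 * ν + 1)) • f y

/-- The operator `P_t`, that is
`P_t f(q ^ r) = ∑_n p_{n r}(t) f(q ^ n)` with
`p_{n r}(t) = (1 - q) q ^ (2 (ν + 1) n) * heatKernel q ν t (q ^ r) (q ^ n)`. -/
def heatSemigroup (q ν t : ℝ) (f : ℝ → E) (x : ℝ) : E :=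
  jackson q (heatSemigroupIntegrand q ν t f x)

/-- `u` solves `∂_t u = Δ_{q,ν} u` on `[0, ∞) × ℝ_q` with `u(0, ·) = f` (the time derivative at
`t = 0` is one-sided). -/
structure IsHeatSolution (q ν : ℝ) (f : ℝ → E) (u : ℝ → ℝ → E) : Prop where
  initial : ∀ x ∈ Rq q, u 0 x = f x
  equation : ∀ t, 0 ≤ t → ∀ x ∈ Rq q,
    HasDerivWithinAt (fun s => u s x) (qLaplacian q ν (u t) x) (Set.Ici 0) t

/-- The class of solutions in which uniqueness is asked for `f ∈ 𝓛_{q,2,ν}`: the solution is a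
continuous curve in `𝓛_{q,2,ν}` on `[0, ∞)`, and it is bounded on `[a, b] × ℝ_q` for all
`0 < a ≤ b`. -/
structure IsL2HeatSolution (q ν : ℝ) (f : ℝ → E) (u : ℝ → ℝ → E) : Prop
    extends IsHeatSolution q ν f u where
  mem : ∀ t, 0 ≤ t → MemL q 2 ν (u t)
  continuous : ∀ t, 0 ≤ t →
    Tendsto (fun s => normL q 2 ν (fun x => u s x - u t x)) (𝓝[Set.Ici 0] t) (𝓝 0)
  bounded : ∀ a b, 0 < a → a ≤ b → ∃ C : ℝ, ∀ t ∈ Set.Icc a b, ∀ x ∈ Rq q, ‖u t x‖ ≤ C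

end Operators

section Convolution

variable {𝕜 : Type*} [RCLike 𝕜]

/-- The `q`-convolution product `f *_q g = 𝓕_{q,ν} [𝓕_{q,ν} f × 𝓕_{q,ν} g]`. -/
def qConv (q ν : ℝ) (f g : ℝ → 𝕜) : ℝ → 𝕜 :=
  fourier q ν fun z => fourier q ν f z * fourier q ν g z

/-- All the series that define `f *_q g` on `ℝ_q` converge. -/
def QConvDefined (q ν : ℝ) (f g : ℝ → 𝕜) : Prop :=
  FourierDefined q ν f ∧ FourierDefined q ν g ∧
    FourierDefined q ν fun z => fourier q ν f z * fourier q ν g z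

/-- The Gaussian `z ↦ e^{-t z²}`. -/
def gaussian (𝕜 : Type*) [RCLike 𝕜] (t : ℝ) : ℝ → 𝕜 :=
  fun z => ((Real.exp (-t * z ^ 2) : ℝ) : 𝕜)

/-- The function `ρ_t = 𝓕_{q,ν} [z ↦ e^{-t z²}]`. -/
def rho (𝕜 : Type*) [RCLike 𝕜] (q ν t : ℝ) : ℝ → 𝕜 :=
  fourier q ν (gaussian 𝕜 t)

end Convolution

end

end QBessel

open QBessel

namespace QBessel

noncomputable section

/-! Put `a = q ^ (2ν+2)`, `β = q ^ (2ν)` and `J n = j_ν(q ^ n, q²)`. On the lattice the transform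
becomes `hankel`, whose kernel `J (m + n)` depends only on the sum of the indices. The recurrence
`besselSeq_recurrence` says that `x ↦ j_ν(x z, q²)` is an eigenfunction of the `q`-Bessel operator
with eigenvalue `-z²`. The heat semigroup is therefore the multiplier `e^{-t z²}` between two
transforms.

Euler's two identities supply the analysis of `J`. They express `(a; q²)_∞ J n` as a series in the
products `(q ^ (2(n+1+l)); q²)_∞`, which vanish for `n + 1 + l ≤ 0`. This gives decay faster than
every power at infinity on the lattice (`exists_abs_besselSeq_le`), and also orthogonality
(`tsum_besselSeq_mul_besselSeq`), since only one term of the resulting series survives.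

For `p ≥ 1` every element of `𝓛_{q,p,ν}` is `Tempered`. This condition makes the double series
behind the transform absolutely convergent, so that inversion (`Tempered.hankel_hankel`), the kernel
formula for `P_t` and differentiation in time follow by interchanging sums. For `p = 2` the
transform is bounded by Young's inequality on `ℤ`, which gives continuity in `𝓛_{q,2,ν}`.

For `ν ≥ 0` uniqueness is an energy argument. The energies `a ^ n |v_n|²` satisfy an inequality
whose right side telescopes into boundary fluxes. The flux at infinity is controlled by the norm.
The flux at the origin, `β ^ (n+1) (|v_{n+1}|² - |v_n|²)`, need not be small for a single `n`. Since
`β ≤ 1`, however, its sum over `M` consecutive end points is bounded uniformly in `M` by Abel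
summation, so its average tends to `0` (`weight_mul_norm_sq_le`).

For `ν < 0`, conjugation by `x ^ (-2ν)` with time rescaled by `q ^ (2ν)` turns solutions of order
`-ν` into solutions of order `ν`. Such a solution vanishes at the origin at each positive time,
because the solution of order `-ν` is bounded there and `x ^ (-2ν) → 0`. But `P_1 ρ_1` has a
positive limit in norm, so the datum `ρ_1` has two solutions. Adding their difference destroys
uniqueness for every datum. -/

lemma summable_of_ratio_tendsto_zero {f r : ℕ → ℝ} (hr : Tendsto r atTop (𝓝 0))
    (h : ∀ n, f (n + 1) = r n * f n) : Summable f := by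
  refine summable_of_ratio_norm_eventually_le (r := 1 / 2) (by norm_num) ?_
  have h1 : Tendsto (fun n => ‖r n‖) atTop (𝓝 0) := by simpa using hr.norm
  filter_upwards [h1.eventually_le_const (show (0 : ℝ) < 1 / 2 by norm_num)] with n hn
  rw [h, norm_mul]
  gcongr

/-! ### `q`-shifted factorials -/

lemma qPoch_zero (a q : ℝ) : qPoch a q 0 = 1 := by simp [qPoch]

lemma qPoch_succ (a q : ℝ) (n : ℕ) : qPoch a q (n + 1) = qPoch a q n * (1 - a * q ^ n) := by
  simp [qPoch, Finset.prod_range_succ]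

lemma one_sub_mul_pow_pos {a p : ℝ} (hp0 : 0 < p) (hp1 : p < 1) (ha0 : 0 ≤ a) (ha1 : a < 1)
    (n : ℕ) : 0 < 1 - a * p ^ n := by
  have : a * p ^ n ≤ a * 1 := by gcongr; exact pow_le_one₀ hp0.le hp1.le
  linarith

lemma qPoch_pos {a p : ℝ} (hp0 : 0 < p) (hp1 : p < 1) (ha0 : 0 ≤ a) (ha1 : a < 1) (n : ℕ) :
    0 < qPoch a p n :=
  Finset.prod_pos fun k _ => one_sub_mul_pow_pos hp0 hp1 ha0 ha1 k

lemma qPoch_le_one {a p : ℝ} (hp0 : 0 < p) (hp1 : p < 1) (ha0 : 0 ≤ a) (ha1 : a ≤ 1) (n : ℕ) :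
    0 ≤ qPoch a p n ∧ qPoch a p n ≤ 1 := by
  have h : ∀ k : ℕ, a * p ^ k ≤ 1 := fun k =>
    mul_le_one₀ ha1 (by positivity) (pow_le_one₀ hp0.le hp1.le)
  refine ⟨Finset.prod_nonneg fun k _ => by linarith [h k],
    Finset.prod_le_one (fun k _ => by linarith [h k]) fun k _ => ?_⟩
  have : 0 ≤ a * p ^ k := by positivity
  linarith

lemma multipliable_qPochInf {p : ℝ} (hp0 : 0 < p) (hp1 : p < 1) (a : ℝ) :
    Multipliable fun k : ℕ => 1 - a * p ^ k := by
  have h : Summable fun k : ℕ => -(a * p ^ k) :=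
    ((summable_geometric_of_lt_one hp0.le hp1).mul_left a).neg
  simpa [sub_eq_add_neg] using Real.multipliable_one_add_of_summable h

lemma tendsto_qPoch {p : ℝ} (hp0 : 0 < p) (hp1 : p < 1) (a : ℝ) :
    Tendsto (qPoch a p) atTop (𝓝 (qPochInf a p)) :=
  (multipliable_qPochInf hp0 hp1 a).hasProd.tendsto_prod_nat

lemma qPoch_mul_qPochInf {p : ℝ} (hp0 : 0 < p) (hp1 : p < 1) (a : ℝ) (n : ℕ) :
    qPoch a p n * qPochInf (a * p ^ n) p = qPochInf a p := by
  have h1 := (tendsto_qPoch hp0 hp1 (a * p ^ n)).const_mul (qPoch a p n)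
  have h2 := (tendsto_qPoch hp0 hp1 a).comp (tendsto_add_atTop_nat n)
  refine tendsto_nhds_unique h1 (h2.congr fun m => ?_)
  simp only [Function.comp, qPoch]
  rw [add_comm m n, Finset.prod_range_add]
  congr 1
  refine Finset.prod_congr rfl fun k _ => ?_
  ring

lemma qPochInf_mem {a p : ℝ} (hp0 : 0 < p) (hp1 : p < 1) (ha0 : 0 ≤ a) (ha1 : a ≤ 1) :
    0 ≤ qPochInf a p ∧ qPochInf a p ≤ 1 :=
  ⟨ge_of_tendsto' (tendsto_qPoch hp0 hp1 a) fun n => (qPoch_le_one hp0 hp1 ha0 ha1 n).1,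
    le_of_tendsto' (tendsto_qPoch hp0 hp1 a) fun n => (qPoch_le_one hp0 hp1 ha0 ha1 n).2⟩

lemma qPochInf_eq_zero {p : ℝ} (hp0 : 0 < p) (hp1 : p < 1) {a : ℝ} (n : ℕ) (h : a * p ^ n = 1) :
    qPochInf a p = 0 := by
  rw [← qPoch_mul_qPochInf hp0 hp1 a (n + 1), qPoch_succ, h]
  simp

/-! ### Euler's identities -/

/-- A function with `G x = (1 - x) G (p x)` that is continuous at `0` is a multiple of
`(x; p)_∞`. -/
lemma eq_qPochInf_mul_of_functional {p : ℝ} (hp0 : 0 < p) (hp1 : p < 1) {G : ℝ → ℝ} {c x : ℝ}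
    (hG : ∀ n : ℕ, G (x * p ^ n) = (1 - x * p ^ n) * G (x * p ^ (n + 1)))
    (h0 : Tendsto (fun n : ℕ => G (x * p ^ n)) atTop (𝓝 c)) :
    G x = qPochInf x p * c := by
  have h : ∀ n : ℕ, G x = qPoch x p n * G (x * p ^ n) := by
    intro n
    induction n with
    | zero => simp [qPoch_zero]
    | succ n ih => rw [ih, hG, qPoch_succ]; ring
  exact tendsto_nhds_unique (tendsto_const_nhds.congr h) ((tendsto_qPoch hp0 hp1 x).mul h0)

/-- A power series on `[-|x|, |x|]` tends to its constant term along `x p ^ n`. -/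
lemma tendsto_powerSeries_mul_pow {p : ℝ} (hp0 : 0 < p) (hp1 : p < 1) {c : ℕ → ℝ} {x : ℝ}
    (hs : Summable fun k => c k * x ^ k) :
    Tendsto (fun n : ℕ => ∑' k, c k * (x * p ^ n) ^ k) atTop (𝓝 (c 0)) := by
  have h : Tendsto (fun n : ℕ => ∑' k, c k * (x * p ^ n) ^ k) atTop
      (𝓝 (∑' k, if k = 0 then c 0 else 0)) := by
    refine tendsto_tsum_of_dominated_convergence (bound := fun k => |c k * x ^ k|) hs.abs ?_ ?_
    · intro k
      rcases Nat.eq_zero_or_pos k with rfl | hk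
      · simp
      · have h1 : Tendsto (fun n : ℕ => p ^ n) atTop (𝓝 0) :=
          tendsto_pow_atTop_nhds_zero_of_lt_one hp0.le hp1
        have h2 := ((h1.const_mul x).pow k).const_mul (c k)
        simpa [hk.ne'] using h2
    · refine Eventually.of_forall fun n k => ?_
      rw [mul_pow, ← mul_assoc, norm_mul, Real.norm_eq_abs, Real.norm_eq_abs]
      refine mul_le_of_le_one_right (abs_nonneg _) ?_
      rw [abs_of_pos (by positivity)]
      exact pow_le_one₀ (by positivity) (pow_le_one₀ hp0.le hp1.le)
  simpa using h

/-- The terms of the expansion of `(x; q²)_∞` in powers of `x`. -/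
def eulerTerm (q x : ℝ) (l : ℕ) : ℝ :=
  (-1) ^ l * (q ^ (l * (l - 1)) / qPoch (q ^ 2) (q ^ 2) l) * x ^ l

lemma pow_two_pos_lt {q : ℝ} (hq0 : 0 < q) (hq1 : q < 1) : 0 < q ^ 2 ∧ q ^ 2 < 1 :=
  ⟨by positivity, pow_lt_one₀ hq0.le hq1 two_ne_zero⟩

lemma tendsto_one_sub_mul_pow {p : ℝ} (hp0 : 0 < p) (hp1 : p < 1) (a : ℝ) :
    Tendsto (fun n : ℕ => 1 - a * p ^ n) atTop (𝓝 1) := by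
  simpa using ((tendsto_pow_atTop_nhds_zero_of_lt_one hp0.le hp1).const_mul a).const_sub 1

lemma eulerTerm_succ {q : ℝ} (hq0 : 0 < q) (hq1 : q < 1) (x : ℝ) (l : ℕ) :
    eulerTerm q x (l + 1) = -(x * (q ^ 2) ^ l / (1 - q ^ 2 * (q ^ 2) ^ l)) * eulerTerm q x l := by
  obtain ⟨hp0, hp1⟩ := pow_two_pos_lt hq0 hq1
  have h1 := (one_sub_mul_pow_pos hp0 hp1 hp0.le hp1 l).ne'
  have h2 := (qPoch_pos hp0 hp1 hp0.le hp1 l).ne'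
  have h3 : q ^ ((l + 1) * (l + 1 - 1)) = q ^ (l * (l - 1)) * (q ^ 2) ^ l := by
    rw [← pow_mul, ← pow_add]
    congr 1
    cases l with
    | zero => rfl
    | succ l => simp only [Nat.add_sub_cancel]; ring
  simp only [eulerTerm]
  rw [qPoch_succ, h3]
  field_simp
  ring

lemma summable_eulerTerm {q : ℝ} (hq0 : 0 < q) (hq1 : q < 1) (x : ℝ) :
    Summable (eulerTerm q x) := by
  obtain ⟨hp0, hp1⟩ := pow_two_pos_lt hq0 hq1
  refine summable_of_ratio_tendsto_zero ?_ (eulerTerm_succ hq0 hq1 x)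
  have h1 := ((tendsto_pow_atTop_nhds_zero_of_lt_one hp0.le hp1).const_mul x).div
    (tendsto_one_sub_mul_pow hp0 hp1 (q ^ 2)) one_ne_zero
  simpa using h1.neg

lemma eulerTerm_mul_pow (q x r : ℝ) (l : ℕ) : eulerTerm q (x * r) l = eulerTerm q x l * r ^ l := by
  simp only [eulerTerm, mul_pow]; ring

/-- Comparing coefficients gives `G y = (1 - y) G (q² y)` for the series, and iterating this down to
the constant term produces the infinite product. -/
lemma tsum_eulerTerm {q : ℝ} (hq0 : 0 < q) (hq1 : q < 1) (x : ℝ) :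
    ∑' l, eulerTerm q x l = qPochInf x (q ^ 2) := by
  obtain ⟨hp0, hp1⟩ := pow_two_pos_lt hq0 hq1
  have key : ∀ y, ∑' l, eulerTerm q y l = (1 - y) * ∑' l, eulerTerm q (y * q ^ 2) l := by
    intro y
    have hs := summable_eulerTerm hq0 hq1 y
    have hs2 := summable_eulerTerm hq0 hq1 (y * q ^ 2)
    have h1 : ∑' l, eulerTerm q y l - ∑' l, eulerTerm q (y * q ^ 2) l
        = ∑' l, -y * eulerTerm q (y * q ^ 2) l := by
      rw [← hs.tsum_sub hs2, (hs.sub hs2).tsum_eq_zero_add]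
      have h0 : eulerTerm q y 0 - eulerTerm q (y * q ^ 2) 0 = 0 := by simp [eulerTerm]
      rw [h0, zero_add]
      refine tsum_congr fun l => ?_
      have h2 := (one_sub_mul_pow_pos hp0 hp1 hp0.le hp1 l).ne'
      rw [eulerTerm_mul_pow q y, eulerTerm_mul_pow q y, eulerTerm_succ hq0 hq1 y]
      field_simp
      ring
    rw [tsum_mul_left] at h1
    linarith
  have h := eq_qPochInf_mul_of_functional hp0 hp1 (G := fun y => ∑' l, eulerTerm q y l) (c := 1)
    (x := x) (fun n => ?_) ?_
  · simpa using h
  · rw [key, pow_succ (q ^ 2) n, mul_assoc]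
  · have h2 := tendsto_powerSeries_mul_pow hp0 hp1 (x := x)
      (c := fun l => (-1) ^ l * (q ^ (l * (l - 1)) / qPoch (q ^ 2) (q ^ 2) l))
      (summable_eulerTerm hq0 hq1 x)
    simpa [qPoch_zero, eulerTerm] using h2

lemma summable_qBinomial {p : ℝ} (hp0 : 0 < p) (hp1 : p < 1) {x : ℝ} (hx0 : 0 < x) (hx1 : x < 1) :
    Summable fun n : ℕ => x ^ n / qPoch p p n := by
  refine summable_of_ratio_test_tendsto_lt_one hx1 (Eventually.of_forall fun n => ?_) ?_
  · exact div_ne_zero (by positivity) (qPoch_pos hp0 hp1 hp0.le hp1 n).ne'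
  · have h1 := (tendsto_const_nhds (x := x)).div (tendsto_one_sub_mul_pow hp0 hp1 p) one_ne_zero
    rw [div_one] at h1
    refine h1.congr fun n => ?_
    simp only [Pi.div_apply]
    have h2 := one_sub_mul_pow_pos hp0 hp1 hp0.le hp1 n
    have h3 := qPoch_pos hp0 hp1 hp0.le hp1 n
    rw [Real.norm_of_nonneg (by have := qPoch_pos hp0 hp1 hp0.le hp1 (n + 1); positivity),
      Real.norm_of_nonneg (by positivity), qPoch_succ]
    field_simp
    ring

/-- The series satisfies `G (y p) = (1 - y) G y`, so `G x * (x; p)_n = G (x p ^ n)`, which tends to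
the constant term `1`. -/
lemma tsum_qBinomial_mul_qPochInf {p : ℝ} (hp0 : 0 < p) (hp1 : p < 1) {x : ℝ} (hx0 : 0 < x)
    (hx1 : x < 1) : (∑' n : ℕ, x ^ n / qPoch p p n) * qPochInf x p = 1 := by
  set G : ℝ → ℝ := fun y => ∑' n : ℕ, y ^ n / qPoch p p n with hG
  have key : ∀ y, 0 < y → y < 1 → G (y * p) = (1 - y) * G y := by
    intro y hy0 hy1
    have hs := summable_qBinomial hp0 hp1 hy0 hy1
    have hs2 := summable_qBinomial hp0 hp1 (mul_pos hy0 hp0)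
      (mul_lt_one_of_nonneg_of_lt_one_left hy0.le hy1 hp1.le)
    have h1 : G y - G (y * p) = ∑' n : ℕ, y * (y ^ n / qPoch p p n) := by
      simp only [hG]
      rw [← hs.tsum_sub hs2, (hs.sub hs2).tsum_eq_zero_add]
      have h0 : y ^ 0 / qPoch p p 0 - (y * p) ^ 0 / qPoch p p 0 = 0 := by simp
      rw [h0, zero_add]
      refine tsum_congr fun n => ?_
      have h2 := (one_sub_mul_pow_pos hp0 hp1 hp0.le hp1 n).ne'
      have h3 := (qPoch_pos hp0 hp1 hp0.le hp1 n).ne'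
      rw [qPoch_succ]
      field_simp
      ring
    rw [tsum_mul_left] at h1
    simp only [hG] at h1 ⊢
    linarith
  have hprod : ∀ n : ℕ, G x * qPoch x p n = G (x * p ^ n) := by
    intro n
    induction n with
    | zero => simp [qPoch_zero]
    | succ n ih =>
      rw [qPoch_succ, ← mul_assoc, ih, pow_succ, ← mul_assoc, key]
      · ring
      · positivity
      · have := one_sub_mul_pow_pos hp0 hp1 hx0.le hx1 n
        linarith
  have h1 := (tendsto_qPoch hp0 hp1 x).const_mul (G x)
  have h2 := tendsto_powerSeries_mul_pow hp0 hp1 (x := x) (c := fun n => (qPoch p p n)⁻¹)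
    (by simpa [div_eq_inv_mul] using summable_qBinomial hp0 hp1 hx0 hx1)
  simp only [qPoch_zero, inv_one] at h2
  refine tendsto_nhds_unique h1 (h2.congr fun n => ?_)
  rw [hprod, hG]
  simp only [div_eq_inv_mul]

/-- Positive factors alone do not exclude the limit `0`; the preceding identity exhibits an inverse.
-/
lemma qPochInf_pos {p : ℝ} (hp0 : 0 < p) (hp1 : p < 1) {x : ℝ} (hx0 : 0 < x) (hx1 : x < 1) :
    0 < qPochInf x p := by
  refine lt_of_le_of_ne (qPochInf_mem hp0 hp1 hx0.le hx1.le).1 fun h => ?_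
  simpa [← h] using tsum_qBinomial_mul_qPochInf hp0 hp1 hx0 hx1

/-! ### The `q`-Bessel function on the lattice -/

lemma weight_mem {q ν : ℝ} (hq0 : 0 < q) (hq1 : q < 1) (hν : -1 < ν) :
    0 < q ^ (2 * ν + 2) ∧ q ^ (2 * ν + 2) < 1 :=
  ⟨Real.rpow_pos_of_pos hq0 _, Real.rpow_lt_one hq0.le hq1 (by linarith)⟩

/-- The terms of the power series of `j_ν(x, q²)`. -/
def besselTerm (q ν x : ℝ) (n : ℕ) : ℝ :=
  (-1) ^ n * (q ^ (n * (n + 1)) /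
    (qPoch (q ^ (2 * ν + 2)) (q ^ 2) n * qPoch (q ^ 2) (q ^ 2) n)) * x ^ (2 * n)

lemma besselJ_eq_tsum (q ν x : ℝ) : besselJ q ν x = ∑' n, besselTerm q ν x n := rfl

lemma besselTerm_mul (q ν x r : ℝ) (n : ℕ) :
    besselTerm q ν (x * r) n = besselTerm q ν x n * r ^ (2 * n) := by
  simp only [besselTerm, mul_pow]; ring

lemma besselTerm_mul_qPoch {q ν : ℝ} (hq0 : 0 < q) (hq1 : q < 1) (hν : -1 < ν) (x : ℝ) (n : ℕ) :
    besselTerm q ν x n * qPoch (q ^ (2 * ν + 2)) (q ^ 2) n = eulerTerm q (q ^ 2 * x ^ 2) n := by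
  obtain ⟨hp0, hp1⟩ := pow_two_pos_lt hq0 hq1
  obtain ⟨ha0, ha1⟩ := weight_mem hq0 hq1 hν
  have h1 := (qPoch_pos hp0 hp1 hp0.le hp1 n).ne'
  have h2 := (qPoch_pos hp0 hp1 ha0.le ha1 n).ne'
  have h3 : q ^ (n * (n + 1)) = q ^ (n * (n - 1)) * (q ^ 2) ^ n := by
    rw [← pow_mul, ← pow_add]
    congr 1
    cases n with
    | zero => rfl
    | succ l => simp only [Nat.add_sub_cancel]; ring
  simp only [eulerTerm, besselTerm]
  rw [h3, mul_pow, pow_mul x]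
  generalize qPoch (q ^ (2 * ν + 2)) (q ^ 2) n = A at *
  field_simp

lemma besselTerm_succ {q ν : ℝ} (hq0 : 0 < q) (hq1 : q < 1) (hν : -1 < ν) (x : ℝ) (n : ℕ) :
    besselTerm q ν x (n + 1) = -(q ^ 2 * x ^ 2 * (q ^ 2) ^ n / ((1 - q ^ (2 * ν + 2) * (q ^ 2) ^ n) *
      (1 - q ^ 2 * (q ^ 2) ^ n))) * besselTerm q ν x n := by
  obtain ⟨hp0, hp1⟩ := pow_two_pos_lt hq0 hq1
  obtain ⟨ha0, ha1⟩ := weight_mem hq0 hq1 hν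
  have h1 := (one_sub_mul_pow_pos hp0 hp1 hp0.le hp1 n).ne'
  have h2 := (one_sub_mul_pow_pos hp0 hp1 ha0.le ha1 n).ne'
  have h3 := (qPoch_pos hp0 hp1 ha0.le ha1 n).ne'
  have h := besselTerm_mul_qPoch hq0 hq1 hν x (n + 1)
  rw [eulerTerm_succ hq0 hq1, ← besselTerm_mul_qPoch hq0 hq1 hν, qPoch_succ] at h
  apply mul_right_cancel₀ (mul_ne_zero h3 h2)
  rw [h]
  generalize qPoch (q ^ (2 * ν + 2)) (q ^ 2) n = A at *
  generalize q ^ (2 * ν + 2) = a at *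
  generalize (q ^ 2) ^ n = P at *
  have h4 : 1 - P * a ≠ 0 := by rwa [mul_comm]
  field_simp

lemma summable_besselTerm {q ν : ℝ} (hq0 : 0 < q) (hq1 : q < 1) (hν : -1 < ν) (x : ℝ) :
    Summable (besselTerm q ν x) := by
  obtain ⟨hp0, hp1⟩ := pow_two_pos_lt hq0 hq1
  refine summable_of_ratio_tendsto_zero ?_ (besselTerm_succ hq0 hq1 hν x)
  have h1 := ((tendsto_pow_atTop_nhds_zero_of_lt_one hp0.le hp1).const_mul (q ^ 2 * x ^ 2)).div
    ((tendsto_one_sub_mul_pow hp0 hp1 (q ^ (2 * ν + 2))).mul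
      (tendsto_one_sub_mul_pow hp0 hp1 (q ^ 2))) (by norm_num)
  simpa using h1.neg

/-- The series of `(a; q²)_∞ j_ν(x, q²)` in powers of `a = q ^ (2 ν + 2)`. -/
lemma qPochInf_mul_besselJ {q ν : ℝ} (hq0 : 0 < q) (hq1 : q < 1) (hν : -1 < ν) (x : ℝ) :
    qPochInf (q ^ (2 * ν + 2)) (q ^ 2) * besselJ q ν x =
      ∑' l, eulerTerm q (q ^ (2 * ν + 2)) l * qPochInf (q ^ 2 * x ^ 2 * (q ^ 2) ^ l) (q ^ 2) := by
  obtain ⟨hp0, hp1⟩ := pow_two_pos_lt hq0 hq1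
  obtain ⟨ha0, ha1⟩ := weight_mem hq0 hq1 hν
  set a := q ^ (2 * ν + 2) with ha
  set z := q ^ 2 * x ^ 2 with hz
  have hsum : Summable (Function.uncurry fun k l : ℕ =>
      eulerTerm q z k * (eulerTerm q a l * ((q ^ 2) ^ k) ^ l)) := by
    refine ((summable_eulerTerm hq0 hq1 z).abs.mul_of_nonneg (summable_eulerTerm hq0 hq1 a).abs
      (fun _ => abs_nonneg _) (fun _ => abs_nonneg _)).of_norm_bounded fun ⟨k, l⟩ => ?_
    simp only [Function.uncurry, norm_mul, Real.norm_eq_abs]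
    refine mul_le_mul_of_nonneg_left (mul_le_of_le_one_right (abs_nonneg _) ?_) (abs_nonneg _)
    rw [abs_of_pos (by positivity)]
    exact pow_le_one₀ (by positivity) (pow_le_one₀ hp0.le hp1.le)
  calc qPochInf a (q ^ 2) * besselJ q ν x
      = ∑' k, ∑' l, eulerTerm q z k * (eulerTerm q a l * ((q ^ 2) ^ k) ^ l) := by
        rw [besselJ_eq_tsum, ← tsum_mul_left]
        refine tsum_congr fun k => ?_
        -- Split `(a; q²)_∞ = (a; q²)_k (a q^{2k}; q²)_∞`: the first factor cancels the denominator
        -- of the Bessel term, the second is expanded by Euler's identity.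
        rw [tsum_mul_left, ← qPoch_mul_qPochInf hp0 hp1 a k, ← tsum_eulerTerm hq0 hq1,
          hz, ← besselTerm_mul_qPoch hq0 hq1 hν]
        simp only [eulerTerm_mul_pow]
        ring
    _ = ∑' l, ∑' k, eulerTerm q z k * (eulerTerm q a l * ((q ^ 2) ^ k) ^ l) := hsum.tsum_comm.symm
    _ = _ := by
        refine tsum_congr fun l => ?_
        rw [← tsum_eulerTerm hq0 hq1, ← tsum_mul_left]
        refine tsum_congr fun k => ?_
        rw [eulerTerm_mul_pow q z, ← pow_mul, ← pow_mul, mul_comm k l]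
        ring

/-- The values of `j_ν(·, q²)` on `ℝ_q`. -/
def besselSeq (q ν : ℝ) (n : ℤ) : ℝ := besselJ q ν (q ^ n)

lemma sq_zpow_mul {q : ℝ} (hq0 : 0 < q) (n : ℤ) (l : ℕ) :
    q ^ 2 * (q ^ n) ^ 2 * (q ^ 2) ^ l = q ^ (2 * (n + 1 + l)) := by
  rw [← zpow_natCast, ← zpow_natCast, ← zpow_natCast, ← zpow_mul, ← zpow_mul, ← zpow_add₀ hq0.ne',
    ← zpow_add₀ hq0.ne']
  congr 1
  push_cast
  ring

lemma qPochInf_mul_besselSeq {q ν : ℝ} (hq0 : 0 < q) (hq1 : q < 1) (hν : -1 < ν) (n : ℤ) :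
    qPochInf (q ^ (2 * ν + 2)) (q ^ 2) * besselSeq q ν n =
      ∑' l : ℕ, eulerTerm q (q ^ (2 * ν + 2)) l * qPochInf (q ^ (2 * (n + 1 + l))) (q ^ 2) := by
  rw [besselSeq, qPochInf_mul_besselJ hq0 hq1 hν]
  simp only [sq_zpow_mul hq0]

/-- The factor with index `-n` is zero. Both the decay of `J` and the orthogonality rest on this. -/
lemma qPochInf_zpow_eq_zero {q : ℝ} (hq0 : 0 < q) (hq1 : q < 1) {n : ℤ} (hn : n ≤ 0) :
    qPochInf (q ^ (2 * n)) (q ^ 2) = 0 := by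
  obtain ⟨hp0, hp1⟩ := pow_two_pos_lt hq0 hq1
  obtain ⟨k, hk⟩ := Int.eq_ofNat_of_zero_le (neg_nonneg.2 hn)
  refine qPochInf_eq_zero hp0 hp1 k ?_
  rw [← pow_mul, ← zpow_natCast, ← zpow_add₀ hq0.ne']
  have : 2 * n + ((2 * k : ℕ) : ℤ) = 0 := by push_cast; omega
  rw [this, zpow_zero]

lemma abs_qPochInf_zpow_le {q : ℝ} (hq0 : 0 < q) (hq1 : q < 1) (n : ℤ) {ρ : ℝ} (hρ0 : 0 < ρ)
    (hρ1 : ρ ≤ 1) : |qPochInf (q ^ (2 * (n + 1))) (q ^ 2)| ≤ ρ ^ (-n) := by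
  obtain ⟨hp0, hp1⟩ := pow_two_pos_lt hq0 hq1
  rcases lt_or_ge n 0 with hn | hn
  · rw [qPochInf_zpow_eq_zero hq0 hq1 (by omega), abs_zero]
    positivity
  · have h := qPochInf_mem hp0 hp1 (a := q ^ (2 * (n + 1))) (by positivity)
      (zpow_le_one₀ hq0 hq1.le (by omega))
    rw [abs_of_nonneg h.1, zpow_neg]
    exact h.2.trans ((one_le_inv₀ (by positivity)).2 (zpow_le_one₀ hρ0 hρ1 hn))

/-- The loss `ρ ^ (-l)` is absorbed into the argument of Euler's series, which converges everywhere.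
-/
lemma abs_eulerTerm_mul_qPochInf_le {q : ℝ} (hq0 : 0 < q) (hq1 : q < 1) (a : ℝ) (n : ℤ) (l : ℕ)
    {ρ : ℝ} (hρ0 : 0 < ρ) (hρ1 : ρ ≤ 1) :
    |eulerTerm q a l * qPochInf (q ^ (2 * (n + 1 + l))) (q ^ 2)| ≤
      ρ ^ (-n) * |eulerTerm q (a * ρ⁻¹) l| := by
  have h := abs_qPochInf_zpow_le hq0 hq1 (n + l) hρ0 hρ1
  rw [show n + l + 1 = n + 1 + (l : ℤ) by ring] at h
  rw [abs_mul, eulerTerm_mul_pow, abs_mul, abs_of_pos (a := ρ⁻¹ ^ l) (by positivity)]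
  calc _ ≤ |eulerTerm q a l| * ρ ^ (-(n + l)) := by gcongr
    _ = _ := by
      rw [neg_add, zpow_add₀ hρ0.ne', zpow_neg ρ l, zpow_natCast, inv_pow]
      ring

/-- On `ℝ_q` the `q`-Bessel function decays at infinity faster than every power. -/
lemma exists_abs_besselSeq_le {q ν : ℝ} (hq0 : 0 < q) (hq1 : q < 1) (hν : -1 < ν) {ρ : ℝ}
    (hρ0 : 0 < ρ) (hρ1 : ρ ≤ 1) : ∃ C, 0 ≤ C ∧ ∀ n, |besselSeq q ν n| ≤ C * ρ ^ (-n) := by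
  obtain ⟨hp0, hp1⟩ := pow_two_pos_lt hq0 hq1
  obtain ⟨ha0, ha1⟩ := weight_mem hq0 hq1 hν
  have hA := qPochInf_pos hp0 hp1 ha0 ha1
  have hs := (summable_eulerTerm hq0 hq1 (q ^ (2 * ν + 2) * ρ⁻¹)).abs
  refine ⟨(∑' l, |eulerTerm q (q ^ (2 * ν + 2) * ρ⁻¹) l|) / qPochInf (q ^ (2 * ν + 2)) (q ^ 2),
    div_nonneg (tsum_nonneg fun _ => abs_nonneg _) hA.le, fun n => ?_⟩
  have h1 : |qPochInf (q ^ (2 * ν + 2)) (q ^ 2) * besselSeq q ν n| ≤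
      ρ ^ (-n) * ∑' l, |eulerTerm q (q ^ (2 * ν + 2) * ρ⁻¹) l| := by
    rw [qPochInf_mul_besselSeq hq0 hq1 hν, ← tsum_mul_left]
    rw [← Real.norm_eq_abs]
    refine tsum_of_norm_bounded (hs.mul_left _).hasSum fun l => ?_
    exact abs_eulerTerm_mul_qPochInf_le hq0 hq1 _ n l hρ0 hρ1
  rw [abs_mul, abs_of_pos hA] at h1
  rw [div_mul_eq_mul_div, le_div_iff₀ hA]
  linarith

lemma summable_pow_natAbs {θ : ℝ} (h0 : 0 < θ) (h1 : θ < 1) :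
    Summable fun n : ℤ => θ ^ n.natAbs := by
  refine Summable.of_nat_of_neg ?_ ?_ <;>
    simpa using summable_geometric_of_lt_one h0.le h1

lemma exists_abs_besselSeq_le_one {q ν : ℝ} (hq0 : 0 < q) (hq1 : q < 1) (hν : -1 < ν) :
    ∃ C, 0 ≤ C ∧ ∀ n, |besselSeq q ν n| ≤ C := by
  simpa using exists_abs_besselSeq_le hq0 hq1 hν one_pos le_rfl

lemma summable_zpow_mul_abs_besselSeq {q ν : ℝ} (hq0 : 0 < q) (hq1 : q < 1) (hν : -1 < ν) {θ : ℝ}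
    (h0 : 0 < θ) (h1 : θ < 1) : Summable fun n : ℤ => θ ^ n * |besselSeq q ν n| := by
  obtain ⟨C, hC0, hC⟩ := exists_abs_besselSeq_le_one hq0 hq1 hν
  -- At `n = -k` the growth `θ ^ (-k)` of the weight is beaten by decay `θ ^ (2k)`, leaving `θ ^ k`.
  obtain ⟨D, hD0, hD⟩ := exists_abs_besselSeq_le hq0 hq1 hν (ρ := θ ^ 2) (by positivity)
    (pow_le_one₀ h0.le h1.le)
  refine ((summable_pow_natAbs h0 h1).mul_left (max C D)).of_nonneg_of_le
    (fun n => by positivity) fun n => ?_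
  rcases le_total 0 n with hn | hn
  · obtain ⟨k, rfl⟩ := Int.eq_ofNat_of_zero_le hn
    rw [Int.natAbs_natCast, zpow_natCast, mul_comm]
    gcongr
    exact (hC _).trans (le_max_left _ _)
  · obtain ⟨k, rfl⟩ := Int.eq_ofNat_of_zero_le (neg_nonneg.2 hn) |>.imp fun k hk => neg_eq_iff_eq_neg.1 hk
    have h2 := hD (-(k : ℤ))
    rw [neg_neg, zpow_natCast, ← pow_mul] at h2
    rw [Int.natAbs_neg, Int.natAbs_natCast, zpow_neg, zpow_natCast, inv_mul_le_iff₀ (by positivity)]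
    calc _ ≤ D * θ ^ (2 * k) := h2
      _ ≤ max C D * θ ^ (2 * k) := by gcongr; exact le_max_right _ _
      _ = _ := by ring

/-- The three-term recurrence of `j_ν` on `ℝ_q`. -/
lemma besselSeq_recurrence {q ν : ℝ} (hq0 : 0 < q) (hq1 : q < 1) (hν : -1 < ν) (n : ℤ) :
    besselSeq q ν (n - 1) - (1 + q ^ (2 * ν)) * besselSeq q ν n +
      q ^ (2 * ν) * besselSeq q ν (n + 1) = -(q ^ n) ^ 2 * besselSeq q ν n := by
  obtain ⟨hp0, hp1⟩ := pow_two_pos_lt hq0 hq1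
  obtain ⟨ha0, ha1⟩ := weight_mem hq0 hq1 hν
  have hs := summable_besselTerm hq0 hq1 hν (q ^ n)
  have hs1 := summable_besselTerm hq0 hq1 hν (q ^ n * q⁻¹)
  have hs2 := summable_besselTerm hq0 hq1 hν (q ^ n * q)
  have hb : q ^ (2 * ν + 2) = q ^ (2 * ν) * q ^ 2 := by
    rw [Real.rpow_add hq0]; norm_num
  have hsum := (hs1.sub (hs.mul_left (1 + q ^ (2 * ν)))).add (hs2.mul_left (q ^ (2 * ν)))
  simp only [besselSeq, zpow_sub_one₀ hq0.ne', zpow_add_one₀ hq0.ne', besselJ_eq_tsum]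
  rw [← tsum_mul_left, ← tsum_mul_left, ← tsum_mul_left, ← hs1.tsum_sub (hs.mul_left _),
    ← (hs1.sub (hs.mul_left _)).tsum_add (hs2.mul_left _), hsum.tsum_eq_zero_add]
  have h0 : besselTerm q ν (q ^ n * q⁻¹) 0 - (1 + q ^ (2 * ν)) * besselTerm q ν (q ^ n) 0 +
      q ^ (2 * ν) * besselTerm q ν (q ^ n * q) 0 = 0 := by
    simp [besselTerm, qPoch_zero]
  rw [h0, zero_add]
  -- With `r = q ^ (2(k+1))` and `β = q ^ (2ν)`, `r⁻¹ - (1 + β) + β r = r⁻¹ (1 - r)(1 - β r)`, which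
  -- cancels the denominator in the ratio of consecutive Bessel terms.
  refine tsum_congr fun k => ?_
  have h1 := (one_sub_mul_pow_pos hp0 hp1 hp0.le hp1 k).ne'
  have h2 := (one_sub_mul_pow_pos hp0 hp1 ha0.le ha1 k).ne'
  rw [besselTerm_mul, besselTerm_mul, besselTerm_succ hq0 hq1 hν]
  rw [hb] at h2 ⊢
  have h3 : q ^ (2 * (k + 1)) = q ^ 2 * (q ^ 2) ^ k := by rw [← pow_mul, ← pow_add]; congr 1; ring
  have h4 : q⁻¹ ^ (2 * (k + 1)) = (q ^ 2 * (q ^ 2) ^ k)⁻¹ := by rw [inv_pow, h3]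
  rw [h3, h4]
  generalize besselTerm q ν (q ^ n) k = B
  generalize hP : (q ^ 2) ^ k = P at *
  have hP0 : P ≠ 0 := by rw [← hP]; positivity
  generalize q ^ n = x
  generalize q ^ (2 * ν) = b at *
  have h5 : 1 - q ^ 2 * P * b ≠ 0 := by rwa [mul_assoc, mul_comm P b, ← mul_assoc, mul_comm _ b]
  field_simp
  ring

/-! ### Orthogonality -/

/-- The product vanishes for `n < -m`, so the sum is one-sided and, after a shift by `m`, equals a
multiple of `∑ a ^ n J (n - m) / (q²; q²)_n`. Expanding `J` and summing over `n` first leaves a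
single Euler series. The right side is zero for `m ≥ 1`. -/
lemma tsum_weight_mul_besselSeq_mul_qPochInf {q ν : ℝ} (hq0 : 0 < q) (hq1 : q < 1) (hν : -1 < ν)
    (m : ℕ) :
    ∑' n : ℤ, (q ^ (2 * ν + 2)) ^ n * besselSeq q ν n * qPochInf (q ^ (2 * (n + 1 + m))) (q ^ 2) =
      (q ^ (2 * ν + 2)) ^ (-(m : ℤ)) * qPochInf (q ^ 2) (q ^ 2) /
        qPochInf (q ^ (2 * ν + 2)) (q ^ 2) * qPochInf (q ^ (2 * (1 - m : ℤ))) (q ^ 2) := by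
  obtain ⟨hp0, hp1⟩ := pow_two_pos_lt hq0 hq1
  obtain ⟨ha0, ha1⟩ := weight_mem hq0 hq1 hν
  have hA := (qPochInf_pos hp0 hp1 ha0 ha1).ne'
  have hterm := besselTerm_mul_qPoch hq0 hq1 hν (q ^ (-(m : ℤ)))
  have hbs := summable_besselTerm hq0 hq1 hν (q ^ (-(m : ℤ)))
  set a := q ^ (2 * ν + 2) with ha
  set φ : ℤ → ℝ := fun n => a ^ n * besselSeq q ν n * qPochInf (q ^ (2 * (n + 1 + m))) (q ^ 2)
  have hsum : Summable (Function.uncurry fun n k : ℕ => a ^ n / qPoch (q ^ 2) (q ^ 2) n *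
      (besselTerm q ν (q ^ (-(m : ℤ))) k * (q ^ n) ^ (2 * k))) := by
    refine ((summable_qBinomial hp0 hp1 ha0 ha1).mul_of_nonneg hbs.abs
      (fun n => by have := qPoch_pos hp0 hp1 hp0.le hp1 n; positivity)
      (fun _ => abs_nonneg _)).of_norm_bounded fun ⟨n, k⟩ => ?_
    have := qPoch_pos hp0 hp1 hp0.le hp1 n
    simp only [Function.uncurry, norm_mul]
    rw [Real.norm_of_nonneg (by positivity : 0 ≤ a ^ n / qPoch (q ^ 2) (q ^ 2) n)]
    refine mul_le_mul_of_nonneg_left (mul_le_of_le_one_right (abs_nonneg _) ?_) (by positivity)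
    rw [Real.norm_of_nonneg (by positivity)]
    exact pow_le_one₀ (by positivity) (pow_le_one₀ hq0.le hq1.le)
  calc ∑' n, φ n = ∑' n : ℤ, φ (n - m) := ((Equiv.subRight (m : ℤ)).tsum_eq φ).symm
    _ = ∑' n : ℕ, φ ((n : ℤ) - m) := by
      refine (Function.Injective.tsum_eq (f := fun n : ℤ => φ (n - m)) (Nat.cast_injective)
        fun n hn => ?_).symm
      by_contra h
      refine hn ?_
      have hn0 : n < 0 := by
        by_contra h'
        exact h ⟨n.toNat, by simp; omega⟩
      simp only [φ]
      rw [qPochInf_zpow_eq_zero hq0 hq1 (by omega), mul_zero]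
    _ = ∑' n : ℕ, ∑' k : ℕ, a ^ (-(m : ℤ)) * qPochInf (q ^ 2) (q ^ 2) *
          (a ^ n / qPoch (q ^ 2) (q ^ 2) n *
          (besselTerm q ν (q ^ (-(m : ℤ))) k * (q ^ n) ^ (2 * k))) := by
      refine tsum_congr fun n => ?_
      have h0 := (qPoch_pos hp0 hp1 hp0.le hp1 n).ne'
      have h1 : qPochInf (q ^ (2 * ((n : ℤ) - m + 1 + m))) (q ^ 2) =
          qPochInf (q ^ 2) (q ^ 2) / qPoch (q ^ 2) (q ^ 2) n := by
        rw [eq_div_iff h0, mul_comm, ← qPoch_mul_qPochInf hp0 hp1 (q ^ 2) n]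
        congr 2
        rw [← pow_mul, ← pow_add, ← zpow_natCast]
        congr 1
        push_cast
        ring
      rw [tsum_mul_left, tsum_mul_left]
      simp only [φ]
      rw [h1, besselSeq, sub_eq_neg_add, zpow_add₀ ha0.ne', zpow_add₀ hq0.ne', besselJ_eq_tsum]
      simp only [besselTerm_mul, zpow_natCast]
      ring
    _ = a ^ (-(m : ℤ)) * qPochInf (q ^ 2) (q ^ 2) * ∑' n : ℕ, ∑' k : ℕ,
          (a ^ n / qPoch (q ^ 2) (q ^ 2) n *
          (besselTerm q ν (q ^ (-(m : ℤ))) k * (q ^ n) ^ (2 * k))) := by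
      simp only [tsum_mul_left]
    _ = a ^ (-(m : ℤ)) * qPochInf (q ^ 2) (q ^ 2) * ∑' k : ℕ, ∑' n : ℕ,
          (a ^ n / qPoch (q ^ 2) (q ^ 2) n *
          (besselTerm q ν (q ^ (-(m : ℤ))) k * (q ^ n) ^ (2 * k))) := by
      rw [hsum.tsum_comm]
    _ = a ^ (-(m : ℤ)) * qPochInf (q ^ 2) (q ^ 2) * ∑' k : ℕ,
          eulerTerm q (q ^ (2 * (1 - m : ℤ))) k / qPochInf a (q ^ 2) := by
      congr 1
      refine tsum_congr fun k => ?_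
      have h0 := (qPoch_pos hp0 hp1 ha0.le ha1 k).ne'
      have h1 : q ^ 2 * (q ^ (-(m : ℤ))) ^ 2 = q ^ (2 * (1 - m : ℤ)) := by
        have := sq_zpow_mul hq0 (-(m : ℤ)) 0
        rw [pow_zero, mul_one] at this
        rw [this]
        congr 1
        push_cast
        ring
      -- The sum over `n` is `1 / (a q^{2k}; q²)_∞ = (a; q²)_k / (a; q²)_∞`, whose numerator turns
      -- the Bessel term into an Euler term.
      have h2 := tsum_qBinomial_mul_qPochInf hp0 hp1 (x := a * (q ^ 2) ^ k) (by positivity) (by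
        have := one_sub_mul_pow_pos hp0 hp1 ha0.le ha1 k
        linarith)
      have h3 : ∀ n : ℕ, a ^ n / qPoch (q ^ 2) (q ^ 2) n *
          (besselTerm q ν (q ^ (-(m : ℤ))) k * (q ^ n) ^ (2 * k)) =
          besselTerm q ν (q ^ (-(m : ℤ))) k *
            ((a * (q ^ 2) ^ k) ^ n / qPoch (q ^ 2) (q ^ 2) n) := by
        intro n
        rw [mul_pow, ← pow_mul q n, ← pow_mul q 2, ← pow_mul q (2 * k), mul_comm n]
        ring
      simp only [h3]
      rw [tsum_mul_left, ← h1, ← hterm, eq_div_iff hA, ← qPoch_mul_qPochInf hp0 hp1 a k,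
        mul_assoc, mul_comm (qPoch a (q ^ 2) k), ← mul_assoc (∑' n : ℕ, _), h2, one_mul]
    _ = _ := by
      rw [tsum_div_const, tsum_eulerTerm hq0 hq1]
      ring

/-- The normalization `(1 - q) c_{q,ν}` of the kernel of the `q`-Bessel Fourier transform. -/
def fourierConst (q ν : ℝ) : ℝ := (1 - q) * cConst q ν

lemma fourierConst_eq {q ν : ℝ} (hq1 : q < 1) :
    fourierConst q ν = qPochInf (q ^ (2 * ν + 2)) (q ^ 2) / qPochInf (q ^ 2) (q ^ 2) := by
  have : 1 - q ≠ 0 := by linarith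
  rw [fourierConst, cConst]
  field_simp

lemma fourierConst_pos {q ν : ℝ} (hq0 : 0 < q) (hq1 : q < 1) (hν : -1 < ν) :
    0 < fourierConst q ν := by
  obtain ⟨hp0, hp1⟩ := pow_two_pos_lt hq0 hq1
  obtain ⟨ha0, ha1⟩ := weight_mem hq0 hq1 hν
  rw [fourierConst_eq hq1]
  exact div_pos (qPochInf_pos hp0 hp1 ha0 ha1) (qPochInf_pos hp0 hp1 hp0 hp1)

/-- Only the second Bessel factor is expanded, in the products `(q ^ (2(n+d+1+l)); q²)_∞`; the
preceding lemma with `m = d + l` kills every term except `d = l = 0`. -/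
lemma tsum_besselSeq_mul_shift {q ν : ℝ} (hq0 : 0 < q) (hq1 : q < 1) (hν : -1 < ν) (d : ℕ) :
    ∑' n : ℤ, (q ^ (2 * ν + 2)) ^ n * besselSeq q ν n * besselSeq q ν (n + d) =
      if d = 0 then (fourierConst q ν ^ 2)⁻¹ else 0 := by
  obtain ⟨hp0, hp1⟩ := pow_two_pos_lt hq0 hq1
  obtain ⟨ha0, ha1⟩ := weight_mem hq0 hq1 hν
  have hA := (qPochInf_pos hp0 hp1 ha0 ha1).ne'
  have hP := (qPochInf_pos hp0 hp1 hp0 hp1).ne'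
  have hJ := qPochInf_mul_besselSeq hq0 hq1 hν
  have hS := tsum_weight_mul_besselSeq_mul_qPochInf hq0 hq1 hν
  have hdec := summable_zpow_mul_abs_besselSeq hq0 hq1 hν ha0 ha1
  have hbound : ∀ (n : ℤ) (l : ℕ), |eulerTerm q (q ^ (2 * ν + 2)) l *
      qPochInf (q ^ (2 * (n + 1 + l))) (q ^ 2)| ≤ |eulerTerm q (q ^ (2 * ν + 2)) l| := by
    intro n l
    simpa using abs_eulerTerm_mul_qPochInf_le hq0 hq1 (q ^ (2 * ν + 2)) n l one_pos le_rfl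
  rw [fourierConst_eq hq1]
  set a := q ^ (2 * ν + 2) with ha
  have hsum : Summable (Function.uncurry fun (n : ℤ) (l : ℕ) => a ^ n * besselSeq q ν n *
      (eulerTerm q a l * qPochInf (q ^ (2 * (n + d + 1 + l))) (q ^ 2))) := by
    refine (hdec.mul_of_nonneg (summable_eulerTerm hq0 hq1 a).abs
      (fun n => by positivity) (fun _ => abs_nonneg _)).of_norm_bounded fun ⟨n, l⟩ => ?_
    simp only [Function.uncurry, Real.norm_eq_abs, abs_mul (a ^ n * besselSeq q ν n)]
    rw [abs_mul (a ^ n), abs_of_pos (a := a ^ n) (by positivity)]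
    exact mul_le_mul_of_nonneg_left (hbound _ _) (by positivity)
  have key : qPochInf a (q ^ 2) * ∑' n : ℤ, a ^ n * besselSeq q ν n * besselSeq q ν (n + d) =
      if d = 0 then qPochInf (q ^ 2) (q ^ 2) ^ 2 / qPochInf a (q ^ 2) else 0 := by
    calc _ = ∑' (n : ℤ) (l : ℕ), a ^ n * besselSeq q ν n *
          (eulerTerm q a l * qPochInf (q ^ (2 * (n + d + 1 + l))) (q ^ 2)) := by
          rw [← tsum_mul_left]
          refine tsum_congr fun n => ?_
          rw [tsum_mul_left, ← hJ]
          ring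
      _ = ∑' (l : ℕ) (n : ℤ), a ^ n * besselSeq q ν n *
          (eulerTerm q a l * qPochInf (q ^ (2 * (n + d + 1 + l))) (q ^ 2)) := hsum.tsum_comm.symm
      _ = ∑' l : ℕ, eulerTerm q a l * (a ^ (-((d + l : ℕ) : ℤ)) * qPochInf (q ^ 2) (q ^ 2) /
            qPochInf a (q ^ 2) * qPochInf (q ^ (2 * (1 - (d + l : ℕ) : ℤ))) (q ^ 2)) := by
          refine tsum_congr fun l => ?_
          rw [← hS, ← tsum_mul_left]
          refine tsum_congr fun n => ?_
          rw [show n + d + 1 + (l : ℤ) = n + 1 + (d + l : ℕ) by push_cast; ring]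
          ring
      _ = _ := by
          have hz : ∀ l : ℕ, d + l ≠ 0 → qPochInf (q ^ (2 * (1 - (d + l : ℕ) : ℤ))) (q ^ 2) = 0 :=
            fun l hl => qPochInf_zpow_eq_zero hq0 hq1 (by omega)
          rw [tsum_eq_single 0]
          · split_ifs with hd
            · subst hd
              have h1 : q ^ (2 * (1 - ((0 + 0 : ℕ) : ℤ))) = q ^ 2 := by
                norm_num
              rw [h1]
              simp [eulerTerm, qPoch_zero]
              ring
            · rw [hz 0 (by omega)]
              ring
          · intro l hl
            rw [hz l (by omega)]
            ring
  rw [eq_comm, ← mul_right_inj' hA, key, eq_comm]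
  split_ifs
  · field_simp
  · simp

lemma tsum_besselSeq_mul_besselSeq {q ν : ℝ} (hq0 : 0 < q) (hq1 : q < 1) (hν : -1 < ν) (n m : ℤ) :
    ∑' k : ℤ, (q ^ (2 * ν + 2)) ^ k * besselSeq q ν (n + k) * besselSeq q ν (m + k) =
      if n = m then (q ^ (2 * ν + 2)) ^ (-n) * (fourierConst q ν ^ 2)⁻¹ else 0 := by
  obtain ⟨ha0, ha1⟩ := weight_mem hq0 hq1 hν
  wlog h : n ≤ m generalizing n m
  · have h1 := this m n (by omega)
    rw [if_neg (by omega)] at h1 ⊢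
    rw [← h1]
    exact tsum_congr fun k => by ring
  obtain ⟨d, rfl⟩ := Int.le.dest h
  have h1 := tsum_besselSeq_mul_shift hq0 hq1 hν d
  rw [← (Equiv.addLeft n).tsum_eq] at h1
  have h2 : (if n = n + (d : ℤ) then (q ^ (2 * ν + 2)) ^ (-n) * (fourierConst q ν ^ 2)⁻¹ else 0) =
      (q ^ (2 * ν + 2)) ^ (-n) * if d = 0 then (fourierConst q ν ^ 2)⁻¹ else 0 := by
    split_ifs <;> first | rfl | omega | simp
  rw [h2, ← h1, ← tsum_mul_left]
  refine tsum_congr fun k => ?_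
  simp only [Equiv.coe_addLeft]
  rw [zpow_add₀ ha0.ne', zpow_neg, show n + k + (d : ℤ) = n + d + k by ring]
  field_simp

/-! ### Sums of exponentials -/

lemma abs_exp_neg_sub_exp_neg_le {x y : ℝ} (hx : 0 ≤ x) (hy : 0 ≤ y) :
    |Real.exp (-x) - Real.exp (-y)| ≤ |x - y| := by
  wlog h : x ≤ y generalizing x y
  · rw [abs_sub_comm, abs_sub_comm x]
    exact this hy hx (le_of_not_ge h)
  rw [abs_of_nonneg (by rw [sub_nonneg]; gcongr), abs_sub_comm x,
    abs_of_nonneg (by linarith)]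
  have h1 : Real.exp (-y) = Real.exp (-x) * Real.exp (-(y - x)) := by
    rw [← Real.exp_add]; ring_nf
  have h2 := Real.add_one_le_exp (-(y - x))
  have h3 : Real.exp (-x) ≤ 1 := Real.exp_le_one_iff.2 (by linarith)
  have h4 := Real.exp_pos (-x)
  rw [h1]
  nlinarith

section

variable {E : Type*} [NormedAddCommGroup E] [NormedSpace ℝ E]

lemma norm_exp_smul_le {t l : ℝ} (ht : 0 ≤ t) (hl : 0 ≤ l) (c : E) :
    ‖Real.exp (-t * l) • c‖ ≤ ‖c‖ := by
  rw [norm_smul, Real.norm_of_nonneg (Real.exp_pos _).le]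
  exact mul_le_of_le_one_left (norm_nonneg _) (Real.exp_le_one_iff.2 (by nlinarith))

/-- The difference quotients of `s ↦ e^{-s l}` on `s ≥ 0` are bounded by `l`, so dominated
convergence applies up to the end point `t = 0`. -/
lemma hasDerivWithinAt_tsum_exp [CompleteSpace E] {ι : Type*} {l : ι → ℝ} {c : ι → E} (hl : ∀ k, 0 ≤ l k)
    (h0 : Summable fun k => ‖c k‖) (h1 : Summable fun k => l k * ‖c k‖) {t : ℝ} (ht : 0 ≤ t) :
    HasDerivWithinAt (fun s => ∑' k, Real.exp (-s * l k) • c k)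
      (∑' k, (-l k * Real.exp (-t * l k)) • c k) (Set.Ici 0) t := by
  have hs : ∀ s : ℝ, 0 ≤ s → Summable fun k => Real.exp (-s * l k) • c k := fun s hs =>
    h0.of_norm_bounded fun k => norm_exp_smul_le hs (hl k) _
  rw [hasDerivWithinAt_iff_tendsto_slope]
  have key : Tendsto
      (fun s => ∑' k, ((s - t)⁻¹ * (Real.exp (-s * l k) - Real.exp (-t * l k))) • c k)
      (𝓝[Set.Ici 0 \ {t}] t) (𝓝 (∑' k, (-l k * Real.exp (-t * l k)) • c k)) := by
    refine tendsto_tsum_of_dominated_convergence h1 (fun k => ?_) ?_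
    · refine Tendsto.smul_const ?_ _
      have hd : HasDerivAt (fun s => Real.exp (-s * l k)) (-l k * Real.exp (-t * l k)) t := by
        have := ((hasDerivAt_id t).neg.mul_const (l k)).exp
        simpa [mul_comm] using this
      have hd := hasDerivWithinAt_iff_tendsto_slope.1 (hd.hasDerivWithinAt (s := Set.Ici 0))
      simpa [slope_def_field, div_eq_inv_mul, slope_fun_def] using hd
    · filter_upwards [self_mem_nhdsWithin] with s hs k
      have hne : s - t ≠ 0 := sub_ne_zero.2 fun h => hs.2 (by simp [h])
      have hs0 : 0 ≤ s := hs.1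
      have h2 := abs_exp_neg_sub_exp_neg_le (mul_nonneg hs0 (hl k)) (mul_nonneg ht (hl k))
      rw [← sub_mul, abs_mul, abs_of_nonneg (hl k)] at h2
      rw [norm_smul, norm_mul, norm_inv, Real.norm_eq_abs, Real.norm_eq_abs]
      refine mul_le_mul_of_nonneg_right ?_ (norm_nonneg _)
      rw [inv_mul_le_iff₀ (abs_pos.2 hne)]
      simpa only [neg_mul] using h2
  refine key.congr' ?_
  filter_upwards [self_mem_nhdsWithin] with s hs'
  rw [slope_def_module, ← (hs s hs'.1).tsum_sub (hs t ht), ← tsum_const_smul'']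
  simp only [← sub_smul, smul_smul]

end

section

variable {E : Type*} [NormedAddCommGroup E] {q ν : ℝ}

/-! ### The Fourier transform of sequences -/

/-- A growth condition on sequences under which the `q`-Bessel Fourier transform is defined and
can be inverted. -/
def Tempered (q ν : ℝ) (F : ℤ → E) : Prop :=
  Summable fun n : ℤ => min 1 ((q ^ (2 * ν + 2)) ^ n) * ‖F n‖

lemma summable_besselSeq_add (hq0 : 0 < q) (hq1 : q < 1) (hν : -1 < ν) {θ : ℝ}
    (h0 : 0 < θ) (h1 : θ < 1) (m : ℤ) : Summable fun n : ℤ => θ ^ n * |besselSeq q ν (m + n)| := by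
  have h := ((Equiv.addLeft m).summable_iff.2
    (summable_zpow_mul_abs_besselSeq hq0 hq1 hν h0 h1)).mul_left (θ ^ (-m))
  refine h.congr fun n => ?_
  simp only [Function.comp, Equiv.coe_addLeft]
  rw [← mul_assoc, ← zpow_add₀ h0.ne']
  congr 2
  ring

lemma tsum_besselSeq_add {θ : ℝ} (h0 : 0 < θ) (m : ℤ) :
    ∑' n : ℤ, θ ^ n * |besselSeq q ν (m + n)| = θ ^ (-m) * ∑' n, θ ^ n * |besselSeq q ν n| := by
  rw [← (Equiv.addLeft m).tsum_eq fun n => θ ^ n * |besselSeq q ν n|, ← tsum_mul_left]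
  refine tsum_congr fun n => ?_
  simp only [Equiv.coe_addLeft]
  rw [← mul_assoc, ← zpow_add₀ h0.ne']
  congr 2
  ring

lemma exists_weight_mul_besselSeq_le (hq0 : 0 < q) (hq1 : q < 1) (hν : -1 < ν) (m : ℤ) :
    ∃ C, 0 ≤ C ∧ ∀ n : ℤ, (q ^ (2 * ν + 2)) ^ n * |besselSeq q ν (m + n)| ≤
      C * min 1 ((q ^ (2 * ν + 2)) ^ n) := by
  obtain ⟨ha0, ha1⟩ := weight_mem hq0 hq1 hν
  obtain ⟨C, hC0, hC⟩ := exists_abs_besselSeq_le_one hq0 hq1 hν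
  have hs := summable_besselSeq_add hq0 hq1 hν ha0 ha1 m
  refine ⟨max C (∑' n : ℤ, (q ^ (2 * ν + 2)) ^ n * |besselSeq q ν (m + n)|),
    hC0.trans (le_max_left _ _), fun n => ?_⟩
  rcases min_choice 1 ((q ^ (2 * ν + 2)) ^ n) with h | h <;> rw [h]
  · rw [mul_one]
    exact (hs.le_tsum n fun _ _ => by positivity).trans (le_max_right _ _)
  · rw [mul_comm]
    gcongr
    exact (hC _).trans (le_max_left _ _)

/-- The weight `a ^ k (1 + q ^ (2 k)) |J (m + k)| |J (n + k)|`. -/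
def kernelBound (q ν : ℝ) (m n k : ℤ) : ℝ :=
  (q ^ (2 * ν + 2)) ^ k * (1 + (q ^ k) ^ 2) * |besselSeq q ν (m + k)| * |besselSeq q ν (n + k)|

lemma kernelBound_nonneg (hq0 : 0 < q) (m n k : ℤ) : 0 ≤ kernelBound q ν m n k := by
  have := Real.rpow_pos_of_pos hq0 (2 * ν + 2)
  unfold kernelBound
  positivity

lemma weight_mul_sq_mem (hq0 : 0 < q) (hq1 : q < 1) (hν : -1 < ν) :
    0 < q ^ (2 * ν + 2) * q ^ 2 ∧ q ^ (2 * ν + 2) * q ^ 2 < 1 := by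
  obtain ⟨ha0, ha1⟩ := weight_mem hq0 hq1 hν
  obtain ⟨hp0, hp1⟩ := pow_two_pos_lt hq0 hq1
  exact ⟨by positivity, mul_lt_one_of_nonneg_of_lt_one_left ha0.le ha1 hp1.le⟩

lemma hasSum_weight_mul_besselSeq (hq0 : 0 < q) (hq1 : q < 1) (hν : -1 < ν) (m : ℤ) :
    HasSum (fun k : ℤ => (q ^ (2 * ν + 2)) ^ k * (1 + (q ^ k) ^ 2) * |besselSeq q ν (m + k)|)
      ((q ^ (2 * ν + 2)) ^ (-m) * (∑' k : ℤ, (q ^ (2 * ν + 2)) ^ k * |besselSeq q ν k|) +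
      (q ^ (2 * ν + 2) * q ^ 2) ^ (-m) *
        ∑' k : ℤ, (q ^ (2 * ν + 2) * q ^ 2) ^ k * |besselSeq q ν k|) := by
  obtain ⟨ha0, ha1⟩ := weight_mem hq0 hq1 hν
  obtain ⟨hb0, hb1⟩ := weight_mul_sq_mem hq0 hq1 hν
  rw [← tsum_besselSeq_add ha0 m, ← tsum_besselSeq_add hb0 m]
  refine ((summable_besselSeq_add hq0 hq1 hν ha0 ha1 m).hasSum.add
    (summable_besselSeq_add hq0 hq1 hν hb0 hb1 m).hasSum).congr_fun fun k => ?_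
  rw [mul_zpow, ← zpow_natCast q 2, ← zpow_mul, ← zpow_natCast (q ^ k) 2, ← zpow_mul, mul_comm k]
  ring

/-- This estimate dictates the weight `min 1 (a ^ n)` in `Tempered`. The constant may depend on `m`
but not on `n`. -/
lemma exists_kernelBound_le (hq0 : 0 < q) (hq1 : q < 1) (hν : -1 < ν) (m : ℤ) :
    ∃ C, 0 ≤ C ∧ ∀ n : ℤ, Summable (kernelBound q ν m n) ∧
      (q ^ (2 * ν + 2)) ^ n * ∑' k, kernelBound q ν m n k ≤
        C * min 1 ((q ^ (2 * ν + 2)) ^ n) := by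
  obtain ⟨ha0, ha1⟩ := weight_mem hq0 hq1 hν
  obtain ⟨hb0, hb1⟩ := weight_mul_sq_mem hq0 hq1 hν
  obtain ⟨B, hB0, hB⟩ := exists_abs_besselSeq_le_one hq0 hq1 hν
  have hW := hasSum_weight_mul_besselSeq hq0 hq1 hν
  have h1 : ∀ n k, kernelBound q ν m n k ≤
      B * ((q ^ (2 * ν + 2)) ^ k * (1 + (q ^ k) ^ 2) * |besselSeq q ν (m + k)|) := by
    intro n k
    rw [kernelBound, mul_comm]
    gcongr
    exact hB _
  have h2 : ∀ n k, kernelBound q ν m n k ≤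
      B * ((q ^ (2 * ν + 2)) ^ k * (1 + (q ^ k) ^ 2) * |besselSeq q ν (n + k)|) := by
    intro n k
    rw [kernelBound, mul_right_comm, mul_comm]
    gcongr
    exact hB _
  set a := q ^ (2 * ν + 2)
  set S1 := ∑' k : ℤ, a ^ k * |besselSeq q ν k|
  set S2 := ∑' k : ℤ, (a * q ^ 2) ^ k * |besselSeq q ν k|
  have hS1 : 0 ≤ S1 := tsum_nonneg fun _ => by positivity
  have hS2 : 0 ≤ S2 := tsum_nonneg fun _ => by positivity
  set V := a ^ (-m) * S1 + (a * q ^ 2) ^ (-m) * S2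
  have hV : 0 ≤ V := by positivity
  have hs : ∀ n, Summable (kernelBound q ν m n) := fun n =>
    ((hW m).summable.mul_left B).of_nonneg_of_le (kernelBound_nonneg hq0 m n) (h1 n)
  refine ⟨max (B * V) (B * (S1 + S2)), le_max_of_le_left (by positivity), fun n => ⟨hs n, ?_⟩⟩
  -- For `n ≥ 0` the factor `J (n + k)` is bounded and `J (m + k)` is summed. For `n ≤ 0` the roles
  -- are exchanged, and the sum over `k` produces `a ^ (-n)`, which compensates the weight `a ^ n`.
  rcases le_total 0 n with hn | hn
  · have han : a ^ n ≤ 1 := zpow_le_one₀ ha0 ha1.le hn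
    rw [min_eq_right han, mul_comm]
    gcongr
    exact (hasSum_le (h1 n) (hs n).hasSum ((hW m).mul_left B)).trans (le_max_left _ _)
  · have han : 1 ≤ a ^ n := one_le_zpow_of_nonpos₀ ha0 ha1.le hn
    rw [min_eq_left han, mul_one]
    refine le_trans ?_ (le_max_right _ _)
    have hqn : (q ^ 2) ^ (-n) ≤ 1 :=
      zpow_le_one₀ (by positivity) (pow_le_one₀ hq0.le hq1.le) (by omega)
    calc _ ≤ a ^ n * (B * (a ^ (-n) * S1 + (a * q ^ 2) ^ (-n) * S2)) := by
          gcongr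
          exact hasSum_le (h2 n) (hs n).hasSum ((hW n).mul_left B)
      _ = B * (S1 + (q ^ 2) ^ (-n) * S2) := by
          rw [mul_zpow, zpow_neg a]
          field_simp
      _ ≤ B * (S1 + 1 * S2) := by gcongr
      _ = _ := by rw [one_mul]

/-- Absolute convergence of the double series behind all manipulations of the transform. -/
lemma Tempered.summable_kernelBound (hq0 : 0 < q) (hq1 : q < 1) (hν : -1 < ν) {F : ℤ → E}
    (hF : Tempered q ν F) (m : ℤ) :
    Summable (Function.uncurry fun n k : ℤ =>
      (q ^ (2 * ν + 2)) ^ n * ‖F n‖ * kernelBound q ν m n k) := by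
  obtain ⟨ha0, ha1⟩ := weight_mem hq0 hq1 hν
  obtain ⟨C, hC0, hC⟩ := exists_kernelBound_le hq0 hq1 hν m
  have hk : ∀ n k, 0 ≤ (q ^ (2 * ν + 2)) ^ n * ‖F n‖ * kernelBound q ν m n k := fun n k =>
    mul_nonneg (by positivity) (kernelBound_nonneg hq0 m n k)
  rw [summable_prod_of_nonneg]
  · refine ⟨fun n => ?_, ?_⟩
    · simpa only [Function.uncurry] using (hC n).1.mul_left ((q ^ (2 * ν + 2)) ^ n * ‖F n‖)
    simp only [Function.uncurry]
    refine (hF.mul_left C).of_nonneg_of_le (fun n => ?_) fun n => ?_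
    · exact tsum_nonneg fun k => hk n k
    · rw [tsum_mul_left]
      calc _ = ((q ^ (2 * ν + 2)) ^ n * ∑' k, kernelBound q ν m n k) * ‖F n‖ := by ring
        _ ≤ C * min 1 ((q ^ (2 * ν + 2)) ^ n) * ‖F n‖ := by
          exact mul_le_mul_of_nonneg_right (hC n).2 (norm_nonneg _)
        _ = _ := by ring
  · rintro ⟨n, k⟩
    exact hk n k

variable [NormedSpace ℝ E]

/-- The `q`-Bessel Fourier transform in terms of the values on `ℝ_q`. -/
def hankel (q ν : ℝ) (F : ℤ → E) (m : ℤ) : E :=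
  ∑' n : ℤ, (fourierConst q ν * ((q ^ (2 * ν + 2)) ^ n * besselSeq q ν (m + n))) • F n

lemma Tempered.summable_hankel (hq0 : 0 < q) (hq1 : q < 1) (hν : -1 < ν) {F : ℤ → E}
    (hF : Tempered q ν F) (m : ℤ) :
    Summable fun n : ℤ =>
      ‖(fourierConst q ν * ((q ^ (2 * ν + 2)) ^ n * besselSeq q ν (m + n))) • F n‖ := by
  obtain ⟨ha0, ha1⟩ := weight_mem hq0 hq1 hν
  have hκ := fourierConst_pos hq0 hq1 hν
  obtain ⟨C, hC0, hC⟩ := exists_weight_mul_besselSeq_le hq0 hq1 hν m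
  refine (hF.mul_left (fourierConst q ν * C)).of_nonneg_of_le (fun n => norm_nonneg _) fun n => ?_
  rw [norm_smul, norm_mul, norm_mul, Real.norm_of_nonneg hκ.le,
    Real.norm_of_nonneg (by positivity : 0 ≤ (q ^ (2 * ν + 2)) ^ n), Real.norm_eq_abs]
  calc _ ≤ fourierConst q ν * (C * min 1 ((q ^ (2 * ν + 2)) ^ n)) * ‖F n‖ := by
        exact mul_le_mul_of_nonneg_right (mul_le_mul_of_nonneg_left (hC n) hκ.le) (norm_nonneg _)
    _ = _ := by ring

/-- The summand `1` serves the inversion formula, the summand `(q ^ k) ^ 2` the time derivative. -/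
lemma Tempered.summable_norm_hankel (hq0 : 0 < q) (hq1 : q < 1) (hν : -1 < ν) {F : ℤ → E}
    (hF : Tempered q ν F) (m : ℤ) :
    Summable fun k : ℤ => (q ^ (2 * ν + 2)) ^ k * (1 + (q ^ k) ^ 2) * |besselSeq q ν (m + k)| *
      ‖hankel q ν F k‖ := by
  obtain ⟨ha0, ha1⟩ := weight_mem hq0 hq1 hν
  have hκ := fourierConst_pos hq0 hq1 hν
  have h := (hF.summable_kernelBound hq0 hq1 hν m).prod_symm.prod.mul_left (fourierConst q ν)
  refine h.of_nonneg_of_le (fun k => by positivity) fun k => ?_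
  have h1 := norm_tsum_le_tsum_norm (hF.summable_hankel hq0 hq1 hν k)
  refine (mul_le_mul_of_nonneg_left h1 (by positivity)).trans_eq ?_
  rw [← tsum_mul_left, ← tsum_mul_left]
  refine tsum_congr fun n => ?_
  rw [norm_smul, norm_mul, norm_mul, Real.norm_of_nonneg hκ.le,
    Real.norm_of_nonneg (by positivity : 0 ≤ (q ^ (2 * ν + 2)) ^ n), Real.norm_eq_abs]
  simp only [Function.uncurry, Prod.swap, kernelBound]
  rw [add_comm k n]
  ring

/-- A bounded multiplier on the transform side acts by an absolutely convergent kernel. -/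
lemma Tempered.hankel_smul_hankel [CompleteSpace E] (hq0 : 0 < q) (hq1 : q < 1) (hν : -1 < ν)
    {F : ℤ → E} (hF : Tempered q ν F) {g : ℤ → ℝ} (hg : ∀ k, |g k| ≤ 1) (m : ℤ) :
    (∀ n, Summable fun k : ℤ => (q ^ (2 * ν + 2)) ^ k * g k * besselSeq q ν (m + k) *
      besselSeq q ν (n + k)) ∧
    HasSum (fun n : ℤ => (fourierConst q ν ^ 2 * ((q ^ (2 * ν + 2)) ^ n *
      ∑' k : ℤ, (q ^ (2 * ν + 2)) ^ k * g k * besselSeq q ν (m + k) * besselSeq q ν (n + k))) •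
        F n) (hankel q ν (fun k => g k • hankel q ν F k) m) := by
  obtain ⟨ha0, ha1⟩ := weight_mem hq0 hq1 hν
  have hκ := fourierConst_pos hq0 hq1 hν
  obtain ⟨C, hC0, hC⟩ := exists_kernelBound_le hq0 hq1 hν m
  have hle : ∀ n k : ℤ, |(q ^ (2 * ν + 2)) ^ k * g k * besselSeq q ν (m + k) *
      besselSeq q ν (n + k)| ≤ kernelBound q ν m n k := by
    intro n k
    rw [kernelBound, abs_mul, abs_mul, abs_mul, abs_of_pos (by positivity)]
    gcongr
    exact (hg k).trans (by nlinarith [sq_nonneg (q ^ k)])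
  have hs1 : ∀ n, Summable fun k : ℤ => (q ^ (2 * ν + 2)) ^ k * g k * besselSeq q ν (m + k) *
      besselSeq q ν (n + k) := fun n => (hC n).1.of_norm_bounded (hle n)
  have hsum : Summable (Function.uncurry fun n k : ℤ => (fourierConst q ν ^ 2 *
      ((q ^ (2 * ν + 2)) ^ n * ((q ^ (2 * ν + 2)) ^ k * g k * besselSeq q ν (m + k) *
        besselSeq q ν (n + k)))) • F n) := by
    refine ((hF.summable_kernelBound hq0 hq1 hν m).mul_left
      (fourierConst q ν ^ 2)).of_norm_bounded fun ⟨n, k⟩ => ?_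
    simp only [Function.uncurry]
    rw [norm_smul, norm_mul, norm_mul, Real.norm_of_nonneg (by positivity),
      Real.norm_of_nonneg (by positivity : 0 ≤ (q ^ (2 * ν + 2)) ^ n), Real.norm_eq_abs]
    calc _ ≤ fourierConst q ν ^ 2 * ((q ^ (2 * ν + 2)) ^ n * kernelBound q ν m n k) * ‖F n‖ := by
          gcongr
          exact hle n k
      _ = _ := by ring
  refine ⟨hs1, ?_⟩
  have h2 : ∀ n, ∑' k : ℤ, (fourierConst q ν ^ 2 *
      ((q ^ (2 * ν + 2)) ^ n * ((q ^ (2 * ν + 2)) ^ k * g k * besselSeq q ν (m + k) *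
        besselSeq q ν (n + k)))) • F n = (fourierConst q ν ^ 2 * ((q ^ (2 * ν + 2)) ^ n *
      ∑' k : ℤ, (q ^ (2 * ν + 2)) ^ k * g k * besselSeq q ν (m + k) * besselSeq q ν (n + k))) •
        F n := by
    intro n
    rw [(((hs1 n).mul_left _).mul_left _).tsum_smul_const, tsum_mul_left, tsum_mul_left]
  have h3 : ∑' n : ℤ, ∑' k : ℤ, (fourierConst q ν ^ 2 *
      ((q ^ (2 * ν + 2)) ^ n * ((q ^ (2 * ν + 2)) ^ k * g k * besselSeq q ν (m + k) *
        besselSeq q ν (n + k)))) • F n = hankel q ν (fun k => g k • hankel q ν F k) m := by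
    rw [← hsum.tsum_comm, hankel]
    refine tsum_congr fun k => ?_
    rw [hankel, ← (hF.summable_hankel hq0 hq1 hν k).of_norm.tsum_const_smul,
      ← ((hF.summable_hankel hq0 hq1 hν k).of_norm.const_smul _).tsum_const_smul]
    refine tsum_congr fun n => ?_
    rw [smul_smul, smul_smul, add_comm k n]
    congr 1
    ring
  rw [← h3]
  simpa only [Function.uncurry, h2] using hsum.prod.hasSum

/-- With multiplier `1` the kernel collapses to the identity by orthogonality. -/
lemma Tempered.hankel_hankel [CompleteSpace E] (hq0 : 0 < q) (hq1 : q < 1) (hν : -1 < ν)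
    {F : ℤ → E} (hF : Tempered q ν F) : hankel q ν (hankel q ν F) = F := by
  obtain ⟨ha0, ha1⟩ := weight_mem hq0 hq1 hν
  have hκ := fourierConst_pos hq0 hq1 hν
  ext m
  have h := (hF.hankel_smul_hankel hq0 hq1 hν (g := fun _ => 1) (by simp) m).2
  simp only [one_smul, mul_one, tsum_besselSeq_mul_besselSeq hq0 hq1 hν] at h
  refine h.unique ?_
  convert hasSum_ite_eq m (F m) using 1
  ext n
  by_cases hn : n = m
  · subst hn
    simp only [if_true]
    rw [zpow_neg, mul_inv_cancel_left₀ (by positivity), mul_inv_cancel₀ (by positivity), one_smul]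
  · rw [if_neg hn, if_neg (Ne.symm hn)]
    simp

/-! ### The heat semigroup on sequences -/

/-- The heat semigroup in terms of the values on `ℝ_q`. -/
def heatSeq (q ν : ℝ) (F : ℤ → E) (t : ℝ) : ℤ → E :=
  hankel q ν fun k => Real.exp (-t * (q ^ k) ^ 2) • hankel q ν F k

lemma heatSeq_zero [CompleteSpace E] (hq0 : 0 < q) (hq1 : q < 1) (hν : -1 < ν)
    {F : ℤ → E} (hF : Tempered q ν F) : heatSeq q ν F 0 = F := by
  simpa [heatSeq] using hF.hankel_hankel hq0 hq1 hν

lemma heatSeq_eq_tsum (F : ℤ → E) (t : ℝ) (m : ℤ) :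
    heatSeq q ν F t m = ∑' k : ℤ, Real.exp (-t * (q ^ k) ^ 2) •
      (fourierConst q ν * ((q ^ (2 * ν + 2)) ^ k * besselSeq q ν (m + k))) • hankel q ν F k := by
  simp only [heatSeq, hankel.eq_1 q ν (fun k => _ • _)]
  exact tsum_congr fun k => smul_comm _ _ _

lemma Tempered.summable_smul_hankel (hq0 : 0 < q) (hq1 : q < 1) (hν : -1 < ν)
    {F : ℤ → E} (hF : Tempered q ν F) (m : ℤ) :
    (Summable fun k : ℤ => ‖(fourierConst q ν * ((q ^ (2 * ν + 2)) ^ k * besselSeq q ν (m + k))) •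
      hankel q ν F k‖) ∧
    Summable fun k : ℤ => (q ^ k) ^ 2 * ‖(fourierConst q ν * ((q ^ (2 * ν + 2)) ^ k *
      besselSeq q ν (m + k))) • hankel q ν F k‖ := by
  obtain ⟨ha0, ha1⟩ := weight_mem hq0 hq1 hν
  have hκ := fourierConst_pos hq0 hq1 hν
  have h := (hF.summable_norm_hankel hq0 hq1 hν m).mul_left (fourierConst q ν)
  have h2 : ∀ k : ℤ, ‖(fourierConst q ν * ((q ^ (2 * ν + 2)) ^ k * besselSeq q ν (m + k))) •
      hankel q ν F k‖ = fourierConst q ν * ((q ^ (2 * ν + 2)) ^ k * |besselSeq q ν (m + k)| *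
        ‖hankel q ν F k‖) := by
    intro k
    rw [norm_smul, norm_mul, norm_mul, Real.norm_of_nonneg hκ.le,
      Real.norm_of_nonneg (by positivity : 0 ≤ (q ^ (2 * ν + 2)) ^ k), Real.norm_eq_abs]
    ring
  have h3 : ∀ k : ℤ, fourierConst q ν * ((q ^ (2 * ν + 2)) ^ k * (1 + (q ^ k) ^ 2) *
      |besselSeq q ν (m + k)| * ‖hankel q ν F k‖) = fourierConst q ν * ((q ^ (2 * ν + 2)) ^ k *
      |besselSeq q ν (m + k)| * ‖hankel q ν F k‖) + (q ^ k) ^ 2 * (fourierConst q ν *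
      ((q ^ (2 * ν + 2)) ^ k * |besselSeq q ν (m + k)| * ‖hankel q ν F k‖)) := fun k => by ring
  simp only [h3] at h
  simp only [h2]
  refine ⟨h.of_nonneg_of_le (fun k => by positivity) fun k => le_add_of_nonneg_right (by positivity),
    h.of_nonneg_of_le (fun k => by positivity) fun k => le_add_of_nonneg_left (by positivity)⟩

/-- Termwise differentiation produces the factor `-(q ^ k) ^ 2`; the recurrence at `m + k`, divided
by `(q ^ m) ^ 2`, produces the same factor from the operator. -/
lemma hasDerivWithinAt_heatSeq [CompleteSpace E] (hq0 : 0 < q) (hq1 : q < 1) (hν : -1 < ν)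
    {F : ℤ → E} (hF : Tempered q ν F) {t : ℝ} (ht : 0 ≤ t) (m : ℤ) :
    HasDerivWithinAt (fun s => heatSeq q ν F s m)
      ((1 / (q ^ m) ^ 2) • (heatSeq q ν F t (m - 1) - (1 + q ^ (2 * ν)) • heatSeq q ν F t m +
        q ^ (2 * ν) • heatSeq q ν F t (m + 1))) (Set.Ici 0) t := by
  have hS := hF.summable_smul_hankel hq0 hq1 hν
  have hs : ∀ m, Summable fun k : ℤ => Real.exp (-t * (q ^ k) ^ 2) •
      (fourierConst q ν * ((q ^ (2 * ν + 2)) ^ k * besselSeq q ν (m + k))) • hankel q ν F k :=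
    fun m => (hS m).1.of_norm_bounded fun k => norm_exp_smul_le ht (by positivity) _
  have h := hasDerivWithinAt_tsum_exp (l := fun k : ℤ => (q ^ k) ^ 2) (fun k => by positivity)
    (hS m).1 (hS m).2 ht
  simp only [← heatSeq_eq_tsum] at h
  convert h using 1
  simp only [heatSeq_eq_tsum]
  rw [← (hs m).tsum_const_smul, ← (hs (m + 1)).tsum_const_smul,
    ← (hs (m - 1)).tsum_sub ((hs m).const_smul _),
    ← ((hs (m - 1)).sub ((hs m).const_smul _)).tsum_add ((hs (m + 1)).const_smul _),
    ← (((hs (m - 1)).sub ((hs m).const_smul _)).add ((hs (m + 1)).const_smul _)).tsum_const_smul]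
  refine tsum_congr fun k => ?_
  simp only [smul_smul, ← sub_smul, ← add_smul]
  congr 1
  have hr := besselSeq_recurrence hq0 hq1 hν (m + k)
  rw [show m - 1 + k = m + k - 1 by ring, show m + 1 + k = m + k + 1 by ring]
  have hm : (q ^ m) ^ 2 ≠ 0 := by positivity
  have e : q ^ (m + k) = q ^ m * q ^ k := zpow_add₀ hq0.ne' _ _
  rw [e] at hr
  generalize besselSeq q ν (m + k - 1) = x at *
  generalize besselSeq q ν (m + k + 1) = y at *
  generalize besselSeq q ν (m + k) = z at *
  rw [one_div, inv_mul_eq_iff_eq_mul₀ hm]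
  linear_combination (Real.exp (-t * (q ^ k) ^ 2) * fourierConst q ν * (q ^ (2 * ν + 2)) ^ k) * hr

end

/-! ### Young's inequality and square-summable sequences -/

lemma tsum_mul_sq_le {ι : Type*} {h g : ι → ℝ} (h0 : ∀ i, 0 ≤ h i) (hh : Summable h)
    (hg : Summable fun i => h i * g i) (hg2 : Summable fun i => h i * g i ^ 2) :
    (∑' i, h i * g i) ^ 2 ≤ (∑' i, h i) * ∑' i, h i * g i ^ 2 := by
  refine le_of_tendsto_of_tendsto' (Tendsto.pow hg.hasSum 2) (Tendsto.mul hh.hasSum hg2.hasSum) fun s => ?_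
  exact Finset.sum_sq_le_sum_mul_sum_of_sq_le_mul s (fun i _ => h0 i)
    (fun i _ => mul_nonneg (h0 i) (sq_nonneg _)) fun i _ => le_of_eq (by ring)

/-- Young's inequality `ℓ¹ * ℓ² ⊆ ℓ²`: Cauchy–Schwarz with weight `h (m + n)`, then summation over
`m` first. -/
lemma summable_sq_tsum_add_mul {h g : ℤ → ℝ} (h0 : ∀ i, 0 ≤ h i) (g0 : ∀ i, 0 ≤ g i)
    (hh : Summable h) (hg : Summable fun i => g i ^ 2) :
    (Summable fun m => (∑' n, h (m + n) * g n) ^ 2) ∧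
    ∑' m, (∑' n, h (m + n) * g n) ^ 2 ≤ (∑' n, h n) ^ 2 * ∑' n, g n ^ 2 := by
  have hshift : ∀ m, Summable fun n => h (m + n) := fun m => (Equiv.addLeft m).summable_iff.2 hh
  have hshift' : ∀ m, ∑' n, h (m + n) = ∑' n, h n := fun m => (Equiv.addLeft m).tsum_eq h
  have hprod : Summable (Function.uncurry fun n m => h (m + n) * g n ^ 2) := by
    rw [summable_prod_of_nonneg]
    · simp only [Function.uncurry, add_comm _ (_ : ℤ), tsum_mul_right]
      refine ⟨fun n => ?_, ?_⟩
      · simpa only [add_comm n] using (hshift n).mul_right (g n ^ 2)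
      · simpa only [hshift', add_comm] using hg.mul_left (∑' n, h n)
    · rintro ⟨n, m⟩
      exact mul_nonneg (h0 _) (sq_nonneg _)
  have h2 : ∀ m, Summable fun n => h (m + n) * g n ^ 2 := fun m => hprod.prod_symm.prod_factor m
  have h1 : ∀ m, Summable fun n => h (m + n) * g n := fun m =>
    ((hshift m).add (h2 m)).of_nonneg_of_le (fun n => mul_nonneg (h0 _) (g0 _)) fun n => by
      nlinarith [h0 (m + n), sq_nonneg (g n - 1), mul_nonneg (h0 (m + n)) (sq_nonneg (g n - 1)),
        mul_nonneg (h0 (m + n)) (g0 n)]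
  have h3 : ∀ m, (∑' n, h (m + n) * g n) ^ 2 ≤ (∑' n, h n) * ∑' n, h (m + n) * g n ^ 2 := by
    intro m
    rw [← hshift' m]
    exact tsum_mul_sq_le (fun n => h0 _) (hshift m) (h1 m) (h2 m)
  have h4 : Summable fun m => (∑' n, h n) * ∑' n, h (m + n) * g n ^ 2 :=
    hprod.prod_symm.prod.mul_left _
  have h5 := h4.of_nonneg_of_le (fun m => sq_nonneg _) h3
  refine ⟨h5, (h5.tsum_le_tsum h3 h4).trans_eq ?_⟩
  rw [tsum_mul_left, hprod.tsum_comm, pow_two, mul_assoc]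
  simp only [tsum_mul_right, fun n => (by simp only [add_comm _ n, hshift'] :
    ∑' m, h (m + n) = ∑' m, h m), tsum_mul_left]

/-! ### Tempered and square-summable sequences -/

section

variable {E : Type*} [NormedAddCommGroup E] {q ν : ℝ}

lemma tempered_of_summable_rpow (hq0 : 0 < q) (hq1 : q < 1) (hν : -1 < ν) {p : ℝ} (hp : 1 ≤ p)
    {F : ℤ → E} (hF : Summable fun n : ℤ => (q ^ (2 * ν + 2)) ^ n * ‖F n‖ ^ p) :
    Tempered q ν F := by
  obtain ⟨ha0, ha1⟩ := weight_mem hq0 hq1 hν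
  set a := q ^ (2 * ν + 2)
  set b := a ^ (1 / p) with hb
  have hp0 : 0 < p := by linarith
  have hb0 : 0 < b := Real.rpow_pos_of_pos ha0 _
  have hb1 : b < 1 := Real.rpow_lt_one ha0.le ha1 (by positivity)
  have hbp : b ^ p = a := by
    rw [hb, ← Real.rpow_mul ha0.le, one_div_mul_cancel hp0.ne', Real.rpow_one]
  have hab : a ≤ b := by
    calc a = b ^ p := hbp.symm
      _ ≤ b ^ (1 : ℝ) := Real.rpow_le_rpow_of_exponent_ge hb0 hb1.le hp
      _ = b := Real.rpow_one b
  -- for `s > 0`: `x ≤ s + s ^ (1 - p) x ^ p`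
  have key : ∀ x s : ℝ, 0 ≤ x → 0 < s → x ≤ s + (s ^ p)⁻¹ * s * x ^ p := by
    intro x s hx hs
    rcases le_total x s with h | h
    · have : 0 ≤ (s ^ p)⁻¹ * s * x ^ p := by positivity
      linarith
    · have h1 : x / s ≤ (x / s) ^ p := by
        have : 1 ≤ x / s := (one_le_div hs).2 h
        calc x / s = (x / s) ^ (1 : ℝ) := (Real.rpow_one _).symm
          _ ≤ _ := Real.rpow_le_rpow_of_exponent_le this hp
      rw [Real.div_rpow hx hs.le, div_le_iff₀ hs] at h1
      have h2 : x ^ p / s ^ p * s = (s ^ p)⁻¹ * s * x ^ p := by ring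
      linarith
  refine ((summable_pow_natAbs hb0 hb1).add hF).of_nonneg_of_le (fun n => by positivity)
    fun n => ?_
  rcases le_total 0 n with hn | hn
  · have han : a ^ n ≤ 1 := zpow_le_one₀ ha0 ha1.le hn
    have h1 := key ‖F n‖ 1 (norm_nonneg _) one_pos
    rw [Real.one_rpow, inv_one, one_mul, one_mul] at h1
    rw [min_eq_right han]
    obtain ⟨k, rfl⟩ := Int.eq_ofNat_of_zero_le hn
    rw [Int.natAbs_natCast, zpow_natCast]
    calc a ^ k * ‖F k‖ ≤ a ^ k * (1 + ‖F k‖ ^ p) := by gcongr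
      _ = a ^ k + a ^ k * ‖F k‖ ^ p := by ring
      _ ≤ _ := by gcongr
  · have han : 1 ≤ a ^ n := one_le_zpow_of_nonpos₀ ha0 ha1.le hn
    rw [min_eq_left han, one_mul]
    -- The choice `s = b ^ |n|` is summable and has `(s ^ p)⁻¹ = a ^ n`; the spare factor `s` is at
    -- most `1`.
    refine (key ‖F n‖ (b ^ n.natAbs) (norm_nonneg _) (by positivity)).trans ?_
    gcongr
    obtain ⟨k, hk⟩ := Int.eq_ofNat_of_zero_le (neg_nonneg.2 hn)
    obtain rfl : n = -k := by omega
    rw [Int.natAbs_neg, Int.natAbs_natCast, zpow_neg, zpow_natCast, ← Real.rpow_natCast b k,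
      ← Real.rpow_mul hb0.le, mul_comm (k : ℝ), Real.rpow_mul hb0.le, hbp, Real.rpow_natCast,
      Real.rpow_natCast]
    exact mul_le_of_le_one_right (by positivity) (pow_le_one₀ hb0.le hb1.le)

/-- Square-summable sequences, that is the values on `ℝ_q` of the elements of `𝓛_{q,2,ν}`. -/
def SqSummable (q ν : ℝ) (F : ℤ → E) : Prop :=
  Summable fun n : ℤ => (q ^ (2 * ν + 2)) ^ n * ‖F n‖ ^ 2

/-- The square of the norm of a square-summable sequence. -/
def sqNorm (q ν : ℝ) (F : ℤ → E) : ℝ := ∑' n : ℤ, (q ^ (2 * ν + 2)) ^ n * ‖F n‖ ^ 2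

lemma SqSummable.tempered (hq0 : 0 < q) (hq1 : q < 1) (hν : -1 < ν) {F : ℤ → E}
    (hF : SqSummable q ν F) : Tempered q ν F :=
  tempered_of_summable_rpow hq0 hq1 hν one_le_two (by simpa [SqSummable] using hF)

lemma SqSummable.of_norm_le (hq0 : 0 < q) {F G : ℤ → E} (hF : SqSummable q ν F)
    (h : ∀ n, ‖G n‖ ≤ ‖F n‖) : SqSummable q ν G := by
  have := Real.rpow_pos_of_pos hq0 (2 * ν + 2)
  refine Summable.of_nonneg_of_le (fun n => by positivity) (fun n => ?_) hF
  gcongr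
  exact h n

lemma sqNorm_nonneg (hq0 : 0 < q) (F : ℤ → E) : 0 ≤ sqNorm q ν F := by
  have := Real.rpow_pos_of_pos hq0 (2 * ν + 2)
  exact tsum_nonneg fun n => by positivity

lemma sq_norm_add_le (x y : E) : ‖x + y‖ ^ 2 ≤ 2 * ‖x‖ ^ 2 + 2 * ‖y‖ ^ 2 := by
  have h := norm_add_le x y
  have h0 := norm_nonneg (x + y)
  nlinarith [sq_nonneg (‖x‖ - ‖y‖)]

lemma SqSummable.add (hq0 : 0 < q) {F G : ℤ → E} (hF : SqSummable q ν F)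
    (hG : SqSummable q ν G) : SqSummable q ν (F + G) := by
  have := Real.rpow_pos_of_pos hq0 (2 * ν + 2)
  refine Summable.of_nonneg_of_le (fun n => by positivity) (fun n => ?_)
    ((hF.mul_left 2).add (hG.mul_left 2))
  have := mul_le_mul_of_nonneg_left (sq_norm_add_le (F n) (G n))
    (by positivity : 0 ≤ (q ^ (2 * ν + 2)) ^ n)
  simp only [Pi.add_apply]
  linarith

lemma sqNorm_add_le (hq0 : 0 < q) {F G : ℤ → E} (hF : SqSummable q ν F)
    (hG : SqSummable q ν G) : sqNorm q ν (F + G) ≤ 2 * sqNorm q ν F + 2 * sqNorm q ν G := by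
  unfold sqNorm
  rw [← tsum_mul_left, ← tsum_mul_left, ← (hF.mul_left 2).tsum_add (hG.mul_left 2)]
  refine (hF.add hq0 hG).tsum_le_tsum (fun n => ?_) ((hF.mul_left 2).add (hG.mul_left 2))
  have := Real.rpow_pos_of_pos hq0 (2 * ν + 2)
  have := mul_le_mul_of_nonneg_left (sq_norm_add_le (F n) (G n))
    (by positivity : 0 ≤ (q ^ (2 * ν + 2)) ^ n)
  simp only [Pi.add_apply]
  linarith

lemma SqSummable.neg {F : ℤ → E} (hF : SqSummable q ν F) : SqSummable q ν (-F) := by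
  simpa [SqSummable] using hF

lemma sqNorm_neg (F : ℤ → E) : sqNorm q ν (-F) = sqNorm q ν F := by simp [sqNorm]

lemma SqSummable.le_sqNorm (hq0 : 0 < q) {F : ℤ → E} (hF : SqSummable q ν F) (n : ℤ) :
    (q ^ (2 * ν + 2)) ^ n * ‖F n‖ ^ 2 ≤ sqNorm q ν F := by
  have := Real.rpow_pos_of_pos hq0 (2 * ν + 2)
  exact hF.le_tsum n fun _ _ => by positivity

variable [NormedSpace ℝ E]

/-- The `q`-Bessel Fourier transform is bounded on square-summable sequences. -/
lemma exists_sqNorm_hankel_le (E : Type*) [NormedAddCommGroup E] [NormedSpace ℝ E] (hq0 : 0 < q)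
    (hq1 : q < 1) (hν : -1 < ν) :
    ∃ C, 0 ≤ C ∧ ∀ F : ℤ → E, SqSummable q ν F →
      SqSummable q ν (hankel q ν F) ∧ sqNorm q ν (hankel q ν F) ≤ C * sqNorm q ν F := by
  obtain ⟨ha0, ha1⟩ := weight_mem hq0 hq1 hν
  have hκ := fourierConst_pos hq0 hq1 hν
  -- Since `α ^ 2 = a`, multiplying sequences by `α ^ n` removes the weight of the norm, and the
  -- kernel becomes the function `κ α ^ n J n` of the sum of the indices, with `κ = fourierConst q
  -- ν`.
  set α := q ^ (ν + 1) with hα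
  have hα0 : 0 < α := Real.rpow_pos_of_pos hq0 _
  have hα1 : α < 1 := Real.rpow_lt_one hq0.le hq1 (by linarith)
  have haα : q ^ (2 * ν + 2) = α ^ 2 := by
    rw [hα, ← Real.rpow_natCast, ← Real.rpow_mul hq0.le]
    congr 1
    push_cast
    ring
  have hz : ∀ n : ℤ, (q ^ (2 * ν + 2)) ^ n = (α ^ n) ^ 2 := by
    intro n
    rw [haα, ← zpow_natCast, ← zpow_natCast, ← zpow_mul, ← zpow_mul, mul_comm]
  set h : ℤ → ℝ := fun n => fourierConst q ν * (α ^ n * |besselSeq q ν n|) with hh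
  have h0 : ∀ n, 0 ≤ h n := fun n => by positivity
  have hsum : Summable h := (summable_zpow_mul_abs_besselSeq hq0 hq1 hν hα0 hα1).mul_left _
  refine ⟨(∑' n, h n) ^ 2, sq_nonneg _, fun F hF => ?_⟩
  have hT := hF.tempered hq0 hq1 hν
  have hg : ∀ n, (q ^ (2 * ν + 2)) ^ n * ‖F n‖ ^ 2 = (α ^ n * ‖F n‖) ^ 2 := fun n => by
    rw [hz, mul_pow]
  unfold SqSummable at hF
  unfold SqSummable sqNorm
  simp only [hg] at hF ⊢
  obtain ⟨h1, h2⟩ := summable_sq_tsum_add_mul (g := fun n => α ^ n * ‖F n‖) h0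
    (fun n => by positivity) hsum hF
  have h3 : ∀ m : ℤ, (q ^ (2 * ν + 2)) ^ m * ‖hankel q ν F m‖ ^ 2 ≤
      (∑' n, h (m + n) * (α ^ n * ‖F n‖)) ^ 2 := by
    intro m
    rw [hz, ← mul_pow]
    gcongr
    refine (mul_le_mul_of_nonneg_left (norm_tsum_le_tsum_norm (hT.summable_hankel hq0 hq1 hν m))
      (by positivity)).trans_eq ?_
    rw [← tsum_mul_left]
    refine tsum_congr fun n => ?_
    rw [norm_smul, norm_mul, norm_mul, Real.norm_of_nonneg hκ.le,
      Real.norm_of_nonneg (by positivity : 0 ≤ (q ^ (2 * ν + 2)) ^ n), Real.norm_eq_abs, hz]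
    simp only [hh]
    rw [zpow_add₀ hα0.ne']
    ring
  have h4 := h1.of_nonneg_of_le (fun m => by positivity) h3
  exact ⟨h4, (h4.tsum_le_tsum h3 h1).trans h2⟩

lemma hankel_sub {F G : ℤ → E} [CompleteSpace E] (hq0 : 0 < q) (hq1 : q < 1) (hν : -1 < ν)
    (hF : Tempered q ν F) (hG : Tempered q ν G) :
    hankel q ν (F - G) = hankel q ν F - hankel q ν G := by
  ext m
  simp only [hankel, Pi.sub_apply, smul_sub]
  exact (hF.summable_hankel hq0 hq1 hν m).of_norm.tsum_sub
    (hG.summable_hankel hq0 hq1 hν m).of_norm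

/-! ### The heat semigroup on square-summable sequences -/

lemma summable_weight_mul_exp (hq0 : 0 < q) (hq1 : q < 1) (hν : -1 < ν) {t : ℝ} (ht : 0 < t) :
    Summable fun k : ℤ => (q ^ (2 * ν + 2)) ^ k * Real.exp (-t * (q ^ k) ^ 2) := by
  obtain ⟨ha0, ha1⟩ := weight_mem hq0 hq1 hν
  obtain ⟨hp0, hp1⟩ := pow_two_pos_lt hq0 hq1
  set a := q ^ (2 * ν + 2)
  -- With `q ^ (2N) < a ^ 2`, the bound `e^{-y} ≤ N! / y ^ N` at `k = -j` gives a constant times `a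
  -- ^ (2j)`, against the weight `a ^ (-j)`.
  obtain ⟨N, hN⟩ := exists_pow_lt_of_lt_one (by positivity : 0 < a ^ 2) hp1
  refine ((summable_pow_natAbs ha0 ha1).mul_left (max 1 (N.factorial / t ^ N))).of_nonneg_of_le
    (fun k => by positivity) fun k => ?_
  rcases le_total 0 k with hk | hk
  · obtain ⟨j, rfl⟩ := Int.eq_ofNat_of_zero_le hk
    rw [Int.natAbs_natCast, zpow_natCast, mul_comm]
    gcongr
    refine le_trans ?_ (le_max_left _ _)
    have : 0 ≤ t * (q ^ (j : ℤ)) ^ 2 := by positivity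
    exact Real.exp_le_one_iff.2 (by linarith)
  · obtain ⟨j, hj⟩ := Int.eq_ofNat_of_zero_le (neg_nonneg.2 hk)
    obtain rfl : k = -j := by omega
    rw [Int.natAbs_neg, Int.natAbs_natCast, zpow_neg, zpow_natCast, zpow_neg, zpow_natCast]
    have h1 := Real.pow_div_factorial_le_exp (t * ((q ^ j)⁻¹) ^ 2) (by positivity) N
    have h2 : Real.exp (-t * ((q ^ j)⁻¹) ^ 2) ≤ N.factorial / t ^ N * ((q ^ 2) ^ N) ^ j := by
      rw [neg_mul, Real.exp_neg, inv_le_comm₀ (Real.exp_pos _) (by positivity)]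
      refine le_trans (le_of_eq ?_) h1
      rw [mul_pow, ← pow_mul, ← pow_mul, ← pow_mul, inv_pow, ← pow_mul,
        show j * (2 * N) = 2 * N * j by ring]
      field_simp
      ring
    calc _ ≤ (a ^ j)⁻¹ * (N.factorial / t ^ N * (a ^ 2) ^ j) := by
          gcongr
          refine h2.trans ?_
          gcongr
      _ = N.factorial / t ^ N * a ^ j := by
          rw [← pow_mul, mul_comm 2, pow_mul]
          field_simp
      _ ≤ _ := by
          gcongr
          exact le_max_right _ _

lemma SqSummable.exp_smul (hq0 : 0 < q) {F : ℤ → E} (hF : SqSummable q ν F) {t : ℝ} (ht : 0 ≤ t) :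
    SqSummable q ν fun k => Real.exp (-t * (q ^ k) ^ 2) • F k :=
  hF.of_norm_le hq0 fun _ => norm_exp_smul_le ht (by positivity) _

lemma SqSummable.heatSeq (hq0 : 0 < q) (hq1 : q < 1) (hν : -1 < ν) {F : ℤ → E}
    (hF : SqSummable q ν F) {t : ℝ} (ht : 0 ≤ t) : SqSummable q ν (heatSeq q ν F t) := by
  obtain ⟨C, hC0, hC⟩ := exists_sqNorm_hankel_le E hq0 hq1 hν
  exact (hC _ ((hC F hF).1.exp_smul hq0 ht)).1

/-- Convergence holds on the transform side by dominated convergence, since two factors in `(0, 1]`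
differ by at most `1`; boundedness of the transform carries it back. -/
lemma tendsto_sqNorm_heatSeq_sub [CompleteSpace E] (hq0 : 0 < q) (hq1 : q < 1) (hν : -1 < ν)
    {F : ℤ → E} (hF : SqSummable q ν F) {t : ℝ} (ht : 0 ≤ t) :
    Tendsto (fun s => sqNorm q ν (QBessel.heatSeq q ν F s - QBessel.heatSeq q ν F t))
      (𝓝[Set.Ici 0] t) (𝓝 0) := by
  obtain ⟨ha0, ha1⟩ := weight_mem hq0 hq1 hν
  obtain ⟨C, hC0, hC⟩ := exists_sqNorm_hankel_le E hq0 hq1 hν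
  have hG := (hC F hF).1
  set G := hankel q ν F with hGdef
  set D : ℝ → ℤ → E := fun s => (fun k => Real.exp (-s * (q ^ k) ^ 2) • G k) -
    fun k => Real.exp (-t * (q ^ k) ^ 2) • G k with hD
  have hDle : ∀ s, 0 ≤ s → ∀ k, ‖D s k‖ ≤ ‖G k‖ := by
    intro s hs k
    have h1 : ∀ r : ℝ, 0 ≤ r → 0 < Real.exp (-r * (q ^ k) ^ 2) ∧ Real.exp (-r * (q ^ k) ^ 2) ≤ 1 :=
      fun r hr => ⟨Real.exp_pos _, Real.exp_le_one_iff.2 (by nlinarith [sq_nonneg (q ^ k)])⟩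
    simp only [hD, Pi.sub_apply, ← sub_smul, norm_smul]
    refine mul_le_of_le_one_left (norm_nonneg _) (abs_le.2 ?_)
    constructor <;> linarith [h1 s hs, h1 t ht]
  have hlim : Tendsto (fun s => C * sqNorm q ν (D s)) (𝓝[Set.Ici 0] t) (𝓝 0) := by
    have h1 : Tendsto (fun s => sqNorm q ν (D s)) (𝓝[Set.Ici 0] t) (𝓝 (∑' _ : ℤ, (0 : ℝ))) := by
      refine tendsto_tsum_of_dominated_convergence hG (fun k => ?_) ?_
      · have h2 : Continuous fun s => (q ^ (2 * ν + 2)) ^ k * ‖D s k‖ ^ 2 := by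
          simp only [hD, Pi.sub_apply]
          fun_prop
        have h3 := (h2.tendsto t).mono_left (nhdsWithin_le_nhds (s := Set.Ici 0))
        simpa [hD] using h3
      · filter_upwards [self_mem_nhdsWithin] with s hs k
        rw [Real.norm_of_nonneg (by positivity)]
        gcongr
        exact hDle s hs k
    simpa using h1.const_mul C
  refine squeeze_zero' (Eventually.of_forall fun s => sqNorm_nonneg hq0 _) ?_ hlim
  filter_upwards [self_mem_nhdsWithin] with s hs
  have h4 : QBessel.heatSeq q ν F s - QBessel.heatSeq q ν F t = hankel q ν (D s) :=
    (hankel_sub hq0 hq1 hν ((hG.exp_smul hq0 hs).tempered hq0 hq1 hν)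
      ((hG.exp_smul hq0 ht).tempered hq0 hq1 hν)).symm
  rw [h4]
  exact (hC _ (hG.of_norm_le hq0 (hDle s hs))).2

/-- For `t ≥ r > 0` the Gaussian turns the weight `a ^ k` into a multiple of `min 1 (a ^ k)`,
against which the transform of `F` is summable; `J` is merely bounded, uniformly in `m`. -/
lemma SqSummable.exists_norm_heatSeq_le (hq0 : 0 < q) (hq1 : q < 1) (hν : -1 < ν)
    {F : ℤ → E} (hF : SqSummable q ν F) {r : ℝ} (hr : 0 < r) :
    ∃ C, ∀ t, r ≤ t → ∀ m, ‖QBessel.heatSeq q ν F t m‖ ≤ C := by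
  obtain ⟨ha0, ha1⟩ := weight_mem hq0 hq1 hν
  have hκ := fourierConst_pos hq0 hq1 hν
  obtain ⟨C, hC0, hC⟩ := exists_sqNorm_hankel_le E hq0 hq1 hν
  obtain ⟨B, hB0, hB⟩ := exists_abs_besselSeq_le_one hq0 hq1 hν
  have hG := ((hC F hF).1).tempered hq0 hq1 hν
  set G := hankel q ν F with hGdef
  have hexp := summable_weight_mul_exp hq0 hq1 hν hr
  set S := ∑' k : ℤ, (q ^ (2 * ν + 2)) ^ k * Real.exp (-r * (q ^ k) ^ 2)
  have hle1 : ∀ k : ℤ, Real.exp (-r * (q ^ k) ^ 2) ≤ 1 := fun k =>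
    Real.exp_le_one_iff.2 (by nlinarith [sq_nonneg (q ^ k)])
  have hS : 0 ≤ S := tsum_nonneg fun _ => by positivity
  have hmin : ∀ k : ℤ, (q ^ (2 * ν + 2)) ^ k * Real.exp (-r * (q ^ k) ^ 2) ≤
      (1 + S) * min 1 ((q ^ (2 * ν + 2)) ^ k) := by
    intro k
    rcases min_choice 1 ((q ^ (2 * ν + 2)) ^ k) with h | h <;> rw [h]
    · have := hexp.le_tsum k fun _ _ => by positivity
      linarith
    · rw [mul_comm]
      gcongr
      linarith [hle1 k]
  refine ⟨∑' k : ℤ, fourierConst q ν * B * (1 + S) *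
    (min 1 ((q ^ (2 * ν + 2)) ^ k) * ‖G k‖), fun t ht m => ?_⟩
  refine tsum_of_norm_bounded (hG.mul_left _).hasSum fun k => ?_
  rw [norm_smul, norm_smul, norm_mul, norm_mul, Real.norm_of_nonneg hκ.le,
    Real.norm_of_nonneg (by positivity : 0 ≤ (q ^ (2 * ν + 2)) ^ k), Real.norm_eq_abs,
    Real.norm_of_nonneg (Real.exp_pos _).le]
  calc _ ≤ fourierConst q ν * ((q ^ (2 * ν + 2)) ^ k * B) *
        (Real.exp (-r * (q ^ k) ^ 2) * ‖G k‖) := by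
        gcongr
        exact hB _
    _ = fourierConst q ν * B * ((q ^ (2 * ν + 2)) ^ k * Real.exp (-r * (q ^ k) ^ 2)) *
        ‖G k‖ := by ring
    _ ≤ fourierConst q ν * B * ((1 + S) * min 1 ((q ^ (2 * ν + 2)) ^ k)) * ‖G k‖ := by
        exact mul_le_mul_of_nonneg_right (mul_le_mul_of_nonneg_left (hmin k) (by positivity))
          (norm_nonneg _)
    _ = _ := by ring

end

/-! ### Functions on `ℝ_q` as sequences -/

/-- The values on `ℝ_q` of a function. -/
def latticeSeq {E : Type*} (q : ℝ) (f : ℝ → E) (n : ℤ) : E := f (q ^ n)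

lemma zpow_mul_zpow_rpow {q : ℝ} (hq0 : 0 < q) (ν : ℝ) (n : ℤ) :
    q ^ n * (q ^ n) ^ (2 * ν + 1) = (q ^ (2 * ν + 2)) ^ n := by
  rw [← Real.rpow_intCast, ← Real.rpow_mul hq0.le, ← Real.rpow_add hq0, ← Real.rpow_intCast,
    ← Real.rpow_mul hq0.le]
  congr 1
  ring

section

variable {E : Type*} [NormedAddCommGroup E] {q ν : ℝ}

lemma memL_iff (hq0 : 0 < q) {p : ℝ} (f : ℝ → E) :
    MemL q p ν f ↔ Summable fun n : ℤ => (q ^ (2 * ν + 2)) ^ n * ‖latticeSeq q f n‖ ^ p := by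
  refine summable_congr fun n => ?_
  rw [← zpow_mul_zpow_rpow hq0, smul_eq_mul, latticeSeq]
  ring

lemma MemL.tempered (hq0 : 0 < q) (hq1 : q < 1) (hν : -1 < ν) {p : ℝ} (hp : 1 ≤ p)
    {f : ℝ → E} (hf : MemL q p ν f) : Tempered q ν (latticeSeq q f) :=
  tempered_of_summable_rpow hq0 hq1 hν hp ((memL_iff hq0 f).1 hf)

lemma memL_two_iff (hq0 : 0 < q) (f : ℝ → E) :
    MemL q 2 ν f ↔ SqSummable q ν (latticeSeq q f) := by
  rw [memL_iff hq0]
  simp [SqSummable]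

lemma normL_two (hq0 : 0 < q) (f : ℝ → E) :
    normL q 2 ν f = √((1 - q) * sqNorm q ν (latticeSeq q f)) := by
  rw [normL, Real.sqrt_eq_rpow]
  congr 1
  rw [jackson, smul_eq_mul, sqNorm]
  congr 1
  refine tsum_congr fun n => ?_
  rw [← zpow_mul_zpow_rpow hq0, smul_eq_mul, latticeSeq, Real.rpow_two]
  ring

lemma tendsto_normL_two_iff (hq0 : 0 < q) (hq1 : q < 1) {ι : Type*} {l : Filter ι}
    (f : ι → ℝ → E) : Tendsto (fun i => normL q 2 ν (f i)) l (𝓝 0) ↔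
      Tendsto (fun i => sqNorm q ν (latticeSeq q (f i))) l (𝓝 0) := by
  have h : 0 < 1 - q := by linarith
  simp only [normL_two hq0]
  constructor
  · intro h1
    have h2 := (h1.pow 2).const_mul (1 - q)⁻¹
    simp only [ne_eq, OfNat.ofNat_ne_zero, not_false_eq_true, zero_pow, mul_zero] at h2
    refine h2.congr fun i => ?_
    rw [Real.sq_sqrt (mul_nonneg h.le (sqNorm_nonneg hq0 _)), inv_mul_cancel_left₀ h.ne']
  · intro h1
    simpa using (h1.const_mul (1 - q)).sqrt

variable [NormedSpace ℝ E]

lemma smul_fourierIntegrand (hq0 : 0 < q) (f : ℝ → E) (m n : ℤ) :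
    (q ^ n) • fourierIntegrand q ν f (q ^ m) (q ^ n) =
      ((q ^ (2 * ν + 2)) ^ n * besselSeq q ν (m + n)) • latticeSeq q f n := by
  rw [fourierIntegrand, smul_smul, ← zpow_mul_zpow_rpow hq0, besselSeq, zpow_add₀ hq0.ne',
    latticeSeq]
  congr 1
  ring

lemma fourier_zpow (hq0 : 0 < q) (f : ℝ → E) (m : ℤ) :
    fourier q ν f (q ^ m) = hankel q ν (latticeSeq q f) m := by
  simp only [fourier, jackson, smul_fourierIntegrand hq0, hankel, fourierConst]
  rw [← tsum_const_smul'', ← tsum_const_smul'']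
  refine tsum_congr fun n => ?_
  rw [smul_smul, smul_smul]
  congr 1
  ring

lemma latticeSeq_fourier (hq0 : 0 < q) (f : ℝ → E) :
    latticeSeq q (fourier q ν f) = hankel q ν (latticeSeq q f) :=
  funext (fourier_zpow hq0 f)

lemma fourierDefined_of_summable [CompleteSpace E] (hq0 : 0 < q) (hq1 : q < 1) (hν : -1 < ν)
    {f : ℝ → E}
    (hf : ∀ m : ℤ, Summable fun n : ℤ => ‖(fourierConst q ν * ((q ^ (2 * ν + 2)) ^ n *
      besselSeq q ν (m + n))) • latticeSeq q f n‖) : FourierDefined q ν f := by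
  rintro _ ⟨m, rfl⟩
  have h := (hf m).of_norm.const_smul (fourierConst q ν)⁻¹
  refine h.congr fun n => ?_
  rw [smul_fourierIntegrand hq0, smul_smul,
    inv_mul_cancel_left₀ (fourierConst_pos hq0 hq1 hν).ne']

lemma fourierDefined_of_tempered [CompleteSpace E] (hq0 : 0 < q) (hq1 : q < 1) (hν : -1 < ν)
    {f : ℝ → E} (hf : Tempered q ν (latticeSeq q f)) : FourierDefined q ν f :=
  fourierDefined_of_summable hq0 hq1 hν fun m => hf.summable_hankel hq0 hq1 hν m

lemma smul_heatKernelIntegrand (hq0 : 0 < q) (t : ℝ) (m n k : ℤ) :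
    (q ^ k) • heatKernelIntegrand q ν t (q ^ m) (q ^ n) (q ^ k) =
      (q ^ (2 * ν + 2)) ^ k * Real.exp (-t * (q ^ k) ^ 2) * besselSeq q ν (m + k) *
        besselSeq q ν (n + k) := by
  rw [heatKernelIntegrand, ← zpow_mul_zpow_rpow hq0, besselSeq, besselSeq, zpow_add₀ hq0.ne',
    zpow_add₀ hq0.ne', smul_eq_mul]
  ring

lemma abs_exp_neg_mul_sq_le_one {t : ℝ} (ht : 0 ≤ t) (x : ℝ) :
    |Real.exp (-t * x ^ 2)| ≤ 1 := by
  rw [abs_of_pos (Real.exp_pos _)]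
  exact Real.exp_le_one_iff.2 (by nlinarith [sq_nonneg x])

lemma jacksonIntegrable_heatKernelIntegrand (hq0 : 0 < q) (hq1 : q < 1) (hν : -1 < ν) {t : ℝ}
    (ht : 0 ≤ t) {x y : ℝ} (hx : x ∈ Rq q) (hy : y ∈ Rq q) :
    JacksonIntegrable q (heatKernelIntegrand q ν t x y) := by
  obtain ⟨m, rfl⟩ := hx
  obtain ⟨n, rfl⟩ := hy
  -- Summability of the kernel series does not involve the sequence, so the zero sequence serves.
  have h0 : Tempered q ν (fun _ : ℤ => (0 : ℝ)) := by simp [Tempered, summable_zero]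
  have h := (h0.hankel_smul_hankel hq0 hq1 hν
    (g := fun k => Real.exp (-t * (q ^ k) ^ 2)) (fun k => abs_exp_neg_mul_sq_le_one ht _) m).1 n
  exact h.congr fun k => (smul_heatKernelIntegrand hq0 t m n k).symm

lemma hasSum_heatSemigroup [CompleteSpace E] (hq0 : 0 < q) (hq1 : q < 1) (hν : -1 < ν) {t : ℝ}
    (ht : 0 ≤ t) {f : ℝ → E} (hf : Tempered q ν (latticeSeq q f)) (m : ℤ) :
    HasSum (fun n : ℤ => (1 - q) • (q ^ n) • heatSemigroupIntegrand q ν t f (q ^ m) (q ^ n))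
      (heatSeq q ν (latticeSeq q f) t m) := by
  have h := (hf.hankel_smul_hankel hq0 hq1 hν
    (g := fun k => Real.exp (-t * (q ^ k) ^ 2)) (fun k => abs_exp_neg_mul_sq_le_one ht _) m).2
  refine h.congr_fun fun n => ?_
  simp only [heatSemigroupIntegrand, heatKernel, jackson, smul_heatKernelIntegrand hq0, smul_smul,
    fourierConst, latticeSeq, smul_eq_mul]
  rw [← zpow_mul_zpow_rpow hq0]
  congr 1
  ring

lemma jacksonIntegrable_heatSemigroupIntegrand [CompleteSpace E] (hq0 : 0 < q) (hq1 : q < 1)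
    (hν : -1 < ν) {t : ℝ} (ht : 0 ≤ t) {f : ℝ → E} (hf : Tempered q ν (latticeSeq q f)) {x : ℝ}
    (hx : x ∈ Rq q) : JacksonIntegrable q (heatSemigroupIntegrand q ν t f x) := by
  obtain ⟨m, rfl⟩ := hx
  have h := (hasSum_heatSemigroup hq0 hq1 hν ht hf m).summable.const_smul (1 - q)⁻¹
  refine h.congr fun n => ?_
  rw [inv_smul_smul₀ (by linarith : 1 - q ≠ 0)]

lemma latticeSeq_heatSemigroup [CompleteSpace E] (hq0 : 0 < q) (hq1 : q < 1) (hν : -1 < ν) {t : ℝ}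
    (ht : 0 ≤ t) {f : ℝ → E} (hf : Tempered q ν (latticeSeq q f)) :
    latticeSeq q (heatSemigroup q ν t f) = heatSeq q ν (latticeSeq q f) t := by
  ext m
  rw [← (hasSum_heatSemigroup hq0 hq1 hν ht hf m).tsum_eq, tsum_const_smul'']
  rfl

lemma qLaplacian_zpow (hq0 : 0 < q) (f : ℝ → E) (m : ℤ) :
    qLaplacian q ν f (q ^ m) = (1 / (q ^ m) ^ 2) • (latticeSeq q f (m - 1) -
      (1 + q ^ (2 * ν)) • latticeSeq q f m + q ^ (2 * ν) • latticeSeq q f (m + 1)) := by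
  simp only [qLaplacian, latticeSeq]
  rw [zpow_sub_one₀ hq0.ne', zpow_add_one₀ hq0.ne', mul_comm q⁻¹, mul_comm q]

lemma isHeatSolution_heatSemigroup [CompleteSpace E] (hq0 : 0 < q) (hq1 : q < 1) (hν : -1 < ν)
    {f : ℝ → E} (hf : Tempered q ν (latticeSeq q f)) :
    IsHeatSolution q ν f fun t => heatSemigroup q ν t f := by
  have h : ∀ t, 0 ≤ t → ∀ m : ℤ, heatSemigroup q ν t f (q ^ m) = heatSeq q ν (latticeSeq q f) t m :=
    fun t ht m => congrFun (latticeSeq_heatSemigroup hq0 hq1 hν ht hf) m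
  constructor
  · rintro _ ⟨m, rfl⟩
    simp only
    rw [h 0 le_rfl, heatSeq_zero hq0 hq1 hν hf, latticeSeq]
  · rintro t ht _ ⟨m, rfl⟩
    simp only
    rw [qLaplacian_zpow hq0, latticeSeq_heatSemigroup hq0 hq1 hν ht hf]
    exact (hasDerivWithinAt_heatSeq hq0 hq1 hν hf ht m).congr (fun s hs => h s hs m) (h t ht m)

lemma isL2HeatSolution_heatSemigroup [CompleteSpace E] (hq0 : 0 < q) (hq1 : q < 1) (hν : -1 < ν)
    {f : ℝ → E} (hf : MemL q 2 ν f) : IsL2HeatSolution q ν f fun t => heatSemigroup q ν t f := by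
  have hT := hf.tempered hq0 hq1 hν one_le_two
  have hS := (memL_two_iff hq0 f).1 hf
  have h := fun t ht => latticeSeq_heatSemigroup (t := t) hq0 hq1 hν ht hT
  refine ⟨isHeatSolution_heatSemigroup hq0 hq1 hν hT, fun t ht => ?_, fun t ht => ?_,
    fun a b ha hab => ?_⟩
  · rw [memL_two_iff hq0, h t ht]
    exact hS.heatSeq hq0 hq1 hν ht
  · rw [tendsto_normL_two_iff hq0 hq1]
    refine (tendsto_sqNorm_heatSeq_sub hq0 hq1 hν hS ht).congr' ?_
    filter_upwards [self_mem_nhdsWithin] with s hs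
    rw [← h s hs, ← h t ht]
    rfl
  · obtain ⟨C, hC⟩ := hS.exists_norm_heatSeq_le hq0 hq1 hν ha
    refine ⟨C, ?_⟩
    rintro t ht _ ⟨m, rfl⟩
    have := hC t ht.1 m
    rwa [← h t (ha.le.trans ht.1)] at this

end

/-! ### Convolution with the Gaussian -/

section

variable {𝕜 : Type*} [RCLike 𝕜] {q ν : ℝ}

lemma norm_gaussian (t x : ℝ) : ‖gaussian 𝕜 t x‖ = Real.exp (-t * x ^ 2) := by
  simp only [gaussian, RCLike.norm_ofReal, abs_of_pos (Real.exp_pos _)]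

lemma tempered_gaussian (hq0 : 0 < q) (hq1 : q < 1) (hν : -1 < ν) {t : ℝ} (ht : 0 < t) :
    Tempered q ν (latticeSeq q (gaussian 𝕜 t)) := by
  have := Real.rpow_pos_of_pos hq0 (2 * ν + 2)
  refine (summable_weight_mul_exp hq0 hq1 hν ht).of_nonneg_of_le (fun n => by positivity)
    fun n => ?_
  rw [latticeSeq, norm_gaussian]
  gcongr
  exact min_le_right _ _

lemma sqSummable_gaussian (hq0 : 0 < q) (hq1 : q < 1) (hν : -1 < ν) {t : ℝ} (ht : 0 < t) :
    SqSummable q ν (latticeSeq q (gaussian 𝕜 t)) := by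
  have := Real.rpow_pos_of_pos hq0 (2 * ν + 2)
  refine Summable.of_nonneg_of_le (fun n => by positivity) (fun n => ?_)
    (summable_weight_mul_exp hq0 hq1 hν ht)
  rw [latticeSeq, norm_gaussian]
  gcongr
  refine pow_le_of_le_one (Real.exp_pos _).le ?_ two_ne_zero
  simpa using abs_exp_neg_mul_sq_le_one ht.le (q ^ n)

lemma latticeSeq_rho (hq0 : 0 < q) (t : ℝ) :
    latticeSeq q (rho 𝕜 q ν t) = hankel q ν (latticeSeq q (gaussian 𝕜 t)) :=
  latticeSeq_fourier hq0 _

lemma hankel_rho (hq0 : 0 < q) (hq1 : q < 1) (hν : -1 < ν) {t : ℝ} (ht : 0 < t) :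
    hankel q ν (latticeSeq q (rho 𝕜 q ν t)) = latticeSeq q (gaussian 𝕜 t) := by
  rw [latticeSeq_rho hq0, (tempered_gaussian hq0 hq1 hν ht).hankel_hankel hq0 hq1 hν]

lemma memL_rho (hq0 : 0 < q) (hq1 : q < 1) (hν : -1 < ν) {t : ℝ} (ht : 0 < t) :
    MemL q 2 ν (rho 𝕜 q ν t) := by
  obtain ⟨C, hC0, hC⟩ := exists_sqNorm_hankel_le 𝕜 hq0 hq1 hν
  rw [memL_two_iff hq0, latticeSeq_rho hq0]
  exact (hC _ (sqSummable_gaussian hq0 hq1 hν ht)).1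

/-- By inversion the transform of `ρ_t` is the Gaussian, so convolution with `ρ_t` is the heat
multiplier. -/
lemma latticeSeq_fourier_rho_mul (hq0 : 0 < q) (hq1 : q < 1) (hν : -1 < ν) {t : ℝ} (ht : 0 < t)
    (f : ℝ → 𝕜) : latticeSeq q (fun z => fourier q ν (rho 𝕜 q ν t) z * fourier q ν f z) =
      fun k => Real.exp (-t * (q ^ k) ^ 2) • hankel q ν (latticeSeq q f) k := by
  ext k
  have h := congrFun (hankel_rho (𝕜 := 𝕜) hq0 hq1 hν ht) k
  rw [← fourier_zpow hq0] at h
  rw [latticeSeq, h, fourier_zpow hq0, latticeSeq, gaussian, RCLike.real_smul_eq_coe_mul]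

lemma qConvDefined_rho (hq0 : 0 < q) (hq1 : q < 1) (hν : -1 < ν) {t : ℝ} (ht : 0 < t)
    {f : ℝ → 𝕜} (hf : Tempered q ν (latticeSeq q f)) : QConvDefined q ν (rho 𝕜 q ν t) f := by
  refine ⟨fourierDefined_of_tempered hq0 hq1 hν ((memL_rho hq0 hq1 hν ht).tempered hq0 hq1 hν
    one_le_two), fourierDefined_of_tempered hq0 hq1 hν hf,
    fourierDefined_of_summable hq0 hq1 hν fun m => ?_⟩
  rw [latticeSeq_fourier_rho_mul hq0 hq1 hν ht]
  refine (hf.summable_smul_hankel hq0 hq1 hν m).1.of_nonneg_of_le (fun k => norm_nonneg _)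
    fun k => ?_
  rw [smul_comm]
  exact norm_exp_smul_le ht.le (by positivity) _

lemma heatSemigroup_eq_qConv (hq0 : 0 < q) (hq1 : q < 1) (hν : -1 < ν) {t : ℝ} (ht : 0 < t)
    {f : ℝ → 𝕜} (hf : Tempered q ν (latticeSeq q f)) {x : ℝ} (hx : x ∈ Rq q) :
    heatSemigroup q ν t f x = qConv q ν (rho 𝕜 q ν t) f x := by
  obtain ⟨m, rfl⟩ := hx
  rw [qConv, fourier_zpow hq0, latticeSeq_fourier_rho_mul hq0 hq1 hν ht]
  exact congrFun (latticeSeq_heatSemigroup hq0 hq1 hν ht.le hf) m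

end

/-! ### Linear combinations and local boundedness of solutions -/

section

variable {E : Type*} [NormedAddCommGroup E] [NormedSpace ℝ E] {q ν : ℝ}

lemma IsL2HeatSolution.sub (hq0 : 0 < q) (hq1 : q < 1) {f g : ℝ → E} {u w : ℝ → ℝ → E}
    (hu : IsL2HeatSolution q ν f u) (hw : IsL2HeatSolution q ν g w) :
    IsL2HeatSolution q ν (fun x => f x - g x) fun t x => u t x - w t x := by
  have hS : ∀ t, 0 ≤ t → SqSummable q ν (latticeSeq q (u t)) := fun t ht =>
    (memL_two_iff hq0 _).1 (hu.mem t ht)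
  have hS' : ∀ t, 0 ≤ t → SqSummable q ν (latticeSeq q (w t)) := fun t ht =>
    (memL_two_iff hq0 _).1 (hw.mem t ht)
  refine ⟨⟨fun x hx => ?_, fun t ht x hx => ?_⟩, fun t ht => ?_, fun t ht => ?_,
    fun a b ha hab => ?_⟩
  · rw [hu.initial x hx, hw.initial x hx]
  · refine ((hu.equation t ht x hx).fun_sub (hw.equation t ht x hx)).congr_deriv ?_
    simp only [qLaplacian]
    module
  · rw [memL_two_iff hq0]
    convert (hS t ht).add hq0 (hS' t ht).neg using 1
    ext n
    simp [latticeSeq, sub_eq_add_neg]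
  · have h1 := (tendsto_normL_two_iff hq0 hq1 _).1 (hu.continuous t ht)
    have h2 := (tendsto_normL_two_iff hq0 hq1 _).1 (hw.continuous t ht)
    rw [tendsto_normL_two_iff hq0 hq1]
    refine squeeze_zero' (Eventually.of_forall fun s => sqNorm_nonneg hq0 _) ?_
      (by simpa using (h1.const_mul 2).add (h2.const_mul 2))
    filter_upwards [self_mem_nhdsWithin] with s hs
    have h3 : SqSummable q ν (latticeSeq q fun x => u s x - u t x) := by
      convert (hS s hs).add hq0 (hS t ht).neg using 1
      ext n
      simp [latticeSeq, sub_eq_add_neg]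
    have h4 : SqSummable q ν (latticeSeq q fun x => w s x - w t x) := by
      convert (hS' s hs).add hq0 (hS' t ht).neg using 1
      ext n
      simp [latticeSeq, sub_eq_add_neg]
    have h5 := sqNorm_add_le hq0 h3 h4.neg
    rw [sqNorm_neg] at h5
    convert h5 using 2
    ext n
    simp only [latticeSeq, Pi.add_apply, Pi.neg_apply]
    abel
  · obtain ⟨C, hC⟩ := hu.bounded a b ha hab
    obtain ⟨D, hD⟩ := hw.bounded a b ha hab
    exact ⟨C + D, fun t ht x hx => (norm_sub_le _ _).trans (add_le_add (hC t ht x hx) (hD t ht x hx))⟩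

/-- Continuity of the curve makes the norm locally bounded in time, and finitely many such
neighbourhoods cover `[0, T]`. -/
lemma IsL2HeatSolution.exists_sqNorm_le (hq0 : 0 < q) (hq1 : q < 1) {f : ℝ → E} {u : ℝ → ℝ → E}
    (hu : IsL2HeatSolution q ν f u) (T : ℝ) :
    ∃ B, ∀ t ∈ Set.Icc 0 T, sqNorm q ν (latticeSeq q (u t)) ≤ B := by
  refine isCompact_Icc.induction_on (p := fun s => ∃ B, ∀ t ∈ s, t ∈ Set.Icc 0 T →
    sqNorm q ν (latticeSeq q (u t)) ≤ B) ⟨0, by simp⟩ ?_ ?_ ?_ |>.imp fun B hB t ht => hB t ht ht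
  · rintro s t hst ⟨B, hB⟩
    exact ⟨B, fun x hx => hB x (hst hx)⟩
  · rintro s t ⟨B, hB⟩ ⟨D, hD⟩
    refine ⟨max B D, ?_⟩
    rintro x (hx | hx) hxT
    · exact (hB x hx hxT).trans (le_max_left _ _)
    · exact (hD x hx hxT).trans (le_max_right _ _)
  · intro t ht
    have h1 := (tendsto_normL_two_iff hq0 hq1 _).1 (hu.continuous t ht.1)
    have h2 := (h1.mono_left (nhdsWithin_mono t fun r (hr : r ∈ Set.Icc 0 T) =>
      hr.1)).eventually_le_const one_pos
    refine ⟨_, h2, 2 * 1 + 2 * sqNorm q ν (latticeSeq q (u t)), fun s hs hsT => ?_⟩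
    have hs' : sqNorm q ν (latticeSeq q fun x => u s x - u t x) ≤ 1 := hs
    have hSs := (memL_two_iff hq0 _).1 (hu.mem s hsT.1)
    have hSt := (memL_two_iff hq0 _).1 (hu.mem t ht.1)
    have h3 : SqSummable q ν (latticeSeq q fun x => u s x - u t x) := by
      convert hSs.add hq0 hSt.neg using 1
      ext n
      simp [latticeSeq, sub_eq_add_neg]
    have h5 := sqNorm_add_le hq0 h3 hSt
    have h6 : latticeSeq q (fun x => u s x - u t x) + latticeSeq q (u t) = latticeSeq q (u s) := by
      ext n
      simp [latticeSeq]
    rw [h6] at h5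
    linarith

end

/-! ### The energy method -/

section

variable {𝕜 : Type*} [RCLike 𝕜] {q ν : ℝ}

/-- The local energy inequality. -/
lemma exists_hasDerivWithinAt_norm_sq (hq0 : 0 < q) {v : ℝ → ℤ → 𝕜} {n : ℤ} {t : ℝ} {S : Set ℝ}
    (hv : HasDerivWithinAt (fun s => v s n) ((1 / (q ^ n) ^ 2) • (v t (n - 1) -
      (1 + q ^ (2 * ν)) • v t n + q ^ (2 * ν) • v t (n + 1))) S t) :
    ∃ D, HasDerivWithinAt (fun s => (q ^ (2 * ν + 2)) ^ n * ‖v s n‖ ^ 2) D S t ∧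
      D ≤ (q ^ (2 * ν)) ^ (n + 1) * (‖v t (n + 1)‖ ^ 2 - ‖v t n‖ ^ 2) -
        (q ^ (2 * ν)) ^ n * (‖v t n‖ ^ 2 - ‖v t (n - 1)‖ ^ 2) := by
  have hβ : 0 < q ^ (2 * ν) := Real.rpow_pos_of_pos hq0 _
  have ha : (q ^ (2 * ν + 2)) ^ n = (q ^ (2 * ν)) ^ n * (q ^ n) ^ 2 := by
    rw [Real.rpow_add hq0, mul_zpow, Real.rpow_two, ← zpow_natCast q 2, ← zpow_mul,
      ← zpow_natCast (q ^ n), ← zpow_mul, mul_comm n]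
  have hqn : (q ^ n) ^ 2 ≠ 0 := by positivity
  have hre := (RCLike.reCLM (K := 𝕜)).hasFDerivAt.comp_hasDerivWithinAt t hv
  have him := (RCLike.imCLM (K := 𝕜)).hasFDerivAt.comp_hasDerivWithinAt t hv
  have hD := (((hre.pow 2).add (him.pow 2)).const_mul ((q ^ (2 * ν + 2)) ^ n))
  have hnorm : ∀ s, (q ^ (2 * ν + 2)) ^ n * ‖v s n‖ ^ 2 =
      (q ^ (2 * ν + 2)) ^ n * (RCLike.re (v s n) ^ 2 + RCLike.im (v s n) ^ 2) := fun s => by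
    rw [RCLike.norm_sq_eq_def, pow_two, pow_two]
  refine ⟨_, hD.congr_of_eventuallyEq (Eventually.of_forall hnorm) (hnorm t), ?_⟩
  · have hbn : 0 < (q ^ (2 * ν)) ^ n := by positivity
    rw [ha, zpow_add_one₀ hβ.ne']
    simp only [RCLike.norm_sq_eq_def, Function.comp, RCLike.reCLM_apply, RCLike.imCLM_apply,
      map_add, map_sub, RCLike.smul_re, RCLike.smul_im, Nat.cast_ofNat, Nat.add_one_sub_one,
      pow_one]
    generalize (q ^ (2 * ν)) ^ n = b at *
    generalize q ^ (2 * ν) = β at *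
    generalize (q ^ n) ^ 2 = Q at *
    generalize RCLike.re (v t n) = x
    generalize RCLike.im (v t n) = x'
    generalize RCLike.re (v t (n - 1)) = y
    generalize RCLike.im (v t (n - 1)) = y'
    generalize RCLike.re (v t (n + 1)) = z
    generalize RCLike.im (v t (n + 1)) = z'
    -- Both differences are estimated by `2 x (w - x) ≤ w² - x²`, for `w = y` and, with weight `β`,
    -- for `w = z`.
    have key : 2 * x * (y - (1 + β) * x + β * z) + 2 * x' * (y' - (1 + β) * x' + β * z') ≤
        β * ((z ^ 2 + z' ^ 2) - (x ^ 2 + x' ^ 2)) - ((x ^ 2 + x' ^ 2) - (y ^ 2 + y' ^ 2)) := by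
      nlinarith [sq_nonneg (x - y), sq_nonneg (x' - y'), mul_nonneg hβ.le (sq_nonneg (z - x)),
        mul_nonneg hβ.le (sq_nonneg (z' - x'))]
    have key2 := mul_le_mul_of_nonneg_left key hbn.le
    refine le_trans (le_of_eq ?_) (key2.trans (le_of_eq ?_))
    · field_simp
    · ring

/-- Abel summation; the bound is independent of `M`. It is applied to `b j = β ^ (n₀ + j)`, which is
antitone because `ν ≥ 0`. -/
lemma sum_mul_sub_le_of_antitone {b z : ℕ → ℝ} {K : ℝ} (hb0 : ∀ j, 0 ≤ b j) (hb : Antitone b)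
    (hz0 : ∀ j, 0 ≤ z j) (hzK : ∀ j, z j ≤ K) (M : ℕ) :
    ∑ j ∈ Finset.range M, b (j + 1) * (z (j + 1) - z j) ≤ b 0 * K := by
  have h : ∀ M, ∑ j ∈ Finset.range M, b (j + 1) * (z (j + 1) - z j) ≤
      b 0 * K + b M * (z M - K) := by
    intro M
    induction M with
    | zero =>
      have := mul_nonneg (hb0 0) (hz0 0)
      simp only [Finset.range_zero, Finset.sum_empty]
      linarith
    | succ M ih =>
      rw [Finset.sum_range_succ]
      have := mul_nonneg (sub_nonneg.2 (hb M.le_succ)) (sub_nonneg.2 (hzK M))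
      simp only [Nat.succ_eq_add_one] at this
      linarith
  have := mul_nonneg (hb0 M) (sub_nonneg.2 (hzK M))
  linarith [h M]

/-- The energy inequality on a finite part of the lattice, averaged over the right end point. -/
lemma weight_mul_norm_sq_le (hq0 : 0 < q) (hq1 : q < 1) (hν0 : 0 ≤ ν) {v : ℝ → ℤ → 𝕜} {s T : ℝ}
    (hs : 0 ≤ s) (hsT : s ≤ T)
    (hv : ∀ t, 0 ≤ t → ∀ n, HasDerivWithinAt (fun r => v r n) ((1 / (q ^ n) ^ 2) • (v t (n - 1) -
      (1 + q ^ (2 * ν)) • v t n + q ^ (2 * ν) • v t (n + 1))) (Set.Ici 0) t)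
    {K B N : ℝ} (hK : ∀ t ∈ Set.Icc s T, ∀ n, ‖v t n‖ ^ 2 ≤ K)
    (hB : ∀ t ∈ Set.Icc s T, ∀ n, (q ^ (2 * ν + 2)) ^ n * ‖v t n‖ ^ 2 ≤ B)
    (hN : ∀ F : Finset ℤ, ∑ n ∈ F, (q ^ (2 * ν + 2)) ^ n * ‖v s n‖ ^ 2 ≤ N) (n₀ : ℤ) (M : ℕ) :
    M * ((q ^ (2 * ν + 2)) ^ n₀ * ‖v T n₀‖ ^ 2) ≤ M * N + ((q ^ (2 * ν)) ^ n₀ * K +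
      M * (q ^ (2 * ν + 2) * (q ^ 2) ^ (-n₀) * (q ^ 2) ^ M * B)) * (T - s) := by
  have hβ0 : 0 < q ^ (2 * ν) := Real.rpow_pos_of_pos hq0 _
  have hβ1 : q ^ (2 * ν) ≤ 1 := Real.rpow_le_one hq0.le hq1.le (by linarith)
  have ha0 : 0 < q ^ (2 * ν + 2) := Real.rpow_pos_of_pos hq0 _
  have haβ : q ^ (2 * ν + 2) = q ^ (2 * ν) * q ^ 2 := by
    rw [Real.rpow_add hq0, Real.rpow_two]
  choose! D hD hDle using fun t ht n => exists_hasDerivWithinAt_norm_sq hq0 (hv t ht n)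
  set a := q ^ (2 * ν + 2)
  set β := q ^ (2 * ν)
  set e : ℝ → ℤ → ℝ := fun t n => a ^ n * ‖v t n‖ ^ 2 with he
  have he0 : ∀ t n, 0 ≤ e t n := fun t n => by positivity
  -- The windows run from `n₀ - M` to `n₀ + j` for `j < M`. Each contains `n₀`, the left end moves
  -- to infinity on the lattice, and summing over `j` averages over the right end.
  set k : ℕ → ℤ := fun i => n₀ - M + i with hk
  set Φ : ℝ → ℝ := fun t => ∑ j ∈ Finset.range M, ∑ i ∈ Finset.range (M + j + 1), e t (k i) with hΦ
  set Φ' : ℝ → ℝ := fun t => ∑ j ∈ Finset.range M, ∑ i ∈ Finset.range (M + j + 1), D t (k i) with hΦ'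
  set Λ := β ^ n₀ * K + M * (a * (q ^ 2) ^ (-n₀) * (q ^ 2) ^ M * B) with hΛ
  have hderiv : ∀ t, 0 ≤ t → HasDerivWithinAt Φ (Φ' t) (Set.Ici 0) t := fun t ht =>
    HasDerivWithinAt.fun_sum fun j _ => HasDerivWithinAt.fun_sum fun i _ => hD t ht (k i)
  -- The bound on `a ^ n |v_n|²` controls the left flux: as `a = β q²`, passing from `a` to `β`
  -- gains the factor `q ^ (2M)`.
  have hbottom : ∀ t ∈ Set.Icc s T, β ^ (n₀ - M) * ‖v t (n₀ - M - 1)‖ ^ 2 ≤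
      a * (q ^ 2) ^ (-n₀) * (q ^ 2) ^ M * B := by
    intro t ht
    have h1 := hB t ht (n₀ - M - 1)
    have h2 : β ^ (n₀ - (M : ℤ)) = a * (q ^ 2) ^ (-n₀) * (q ^ 2) ^ M * a ^ (n₀ - (M : ℤ) - 1) := by
      have hp : q ^ 2 ≠ 0 := by positivity
      rw [zpow_sub_one₀ ha0.ne', zpow_sub₀ ha0.ne', haβ, mul_zpow, mul_zpow, zpow_sub₀ hβ0.ne',
        zpow_neg, zpow_natCast, zpow_natCast]
      field_simp
    rw [h2, mul_assoc _ (a ^ _)]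
    gcongr
  have hΦ'le : ∀ t ∈ Set.Icc s T, Φ' t ≤ Λ := by
    intro t ht
    have ht0 : 0 ≤ t := hs.trans ht.1
    have h1 : ∀ j, ∑ i ∈ Finset.range (M + j + 1), D t (k i) ≤
        β ^ (n₀ + (j + 1 : ℕ)) * (‖v t (n₀ + (j + 1 : ℕ))‖ ^ 2 - ‖v t (n₀ + j)‖ ^ 2) +
          a * (q ^ 2) ^ (-n₀) * (q ^ 2) ^ M * B := by
      intro j
      set g : ℕ → ℝ := fun i => β ^ (k i) * (‖v t (k i)‖ ^ 2 - ‖v t (k i - 1)‖ ^ 2) with hg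
      have h2 : ∀ i ∈ Finset.range (M + j + 1), D t (k i) ≤ g (i + 1) - g i := by
        intro i _
        have h3 : k (i + 1) = k i + 1 := by simp only [hk]; push_cast; ring
        simp only [hg, h3, add_sub_cancel_right]
        exact hDle t ht0 (k i)
      refine (Finset.sum_le_sum h2).trans ?_
      rw [Finset.sum_range_sub]
      have h4 : k (M + j + 1) = n₀ + (j + 1 : ℕ) := by simp only [hk]; push_cast; ring
      have h5 : k 0 = n₀ - M := by simp [hk]
      have h6 : n₀ + (j + 1 : ℕ) - 1 = n₀ + (j : ℤ) := by push_cast; ring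
      have h7 := hbottom t ht
      have h8 : 0 ≤ β ^ (n₀ - M) * ‖v t (n₀ - M)‖ ^ 2 := by positivity
      simp only [hg, h4, h5, h6]
      linarith
    refine (Finset.sum_le_sum fun j _ => h1 j).trans ?_
    rw [Finset.sum_add_distrib, Finset.sum_const, Finset.card_range, nsmul_eq_mul]
    have h9 := sum_mul_sub_le_of_antitone (b := fun j : ℕ => β ^ (n₀ + (j : ℤ)))
      (z := fun j : ℕ => ‖v t (n₀ + (j : ℤ))‖ ^ 2) (K := K) (fun j => by positivity)
      (fun i j hij => zpow_le_zpow_right_of_le_one₀ hβ0 hβ1 (by omega)) (fun j => by positivity)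
      (fun j => hK t ht _) M
    simp only [Nat.cast_zero, add_zero] at h9
    linarith
  have hmean : Φ T ≤ Φ s + Λ * (T - s) := by
    refine image_le_of_deriv_right_le_deriv_boundary (f := Φ) (f' := Φ') (a := s) (b := T)
      (B := fun t => Φ s + Λ * (t - s)) (B' := fun _ => Λ)
      (fun t ht => (hderiv t (hs.trans ht.1)).continuousWithinAt.mono
        fun r hr => hs.trans hr.1)
      (fun t ht => (hderiv t (hs.trans ht.1)).mono fun r hr => (hs.trans ht.1).trans hr)
      (by simp) (by fun_prop) (fun t _ => ?_)
      (fun t ht => hΦ'le t ⟨ht.1, ht.2.le⟩) ⟨hsT, le_rfl⟩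
    have := (((hasDerivAt_id t).sub_const s).const_mul Λ).const_add (Φ s)
    simpa using this.hasDerivWithinAt
  have hinj : Function.Injective k := fun i j h => by
    simp only [hk] at h
    omega
  have hlow : M * e T n₀ ≤ Φ T := by
    have h1 : ∀ j ∈ Finset.range M, e T n₀ ≤ ∑ i ∈ Finset.range (M + j + 1), e T (k i) := by
      intro j _
      have h2 : k M = n₀ := by simp [hk]
      rw [← h2]
      exact Finset.single_le_sum (f := fun i => e T (k i)) (fun i _ => he0 T (k i))
        (Finset.mem_range.2 (by omega))
    simpa using Finset.sum_le_sum h1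
  have hup : Φ s ≤ M * N := by
    have h1 : ∀ j ∈ Finset.range M, ∑ i ∈ Finset.range (M + j + 1), e s (k i) ≤ N := by
      intro j _
      simpa using hN ((Finset.range (M + j + 1)).map ⟨k, hinj⟩)
    simpa using Finset.sum_le_sum h1
  linarith

/-- For `ν ≥ 0` a solution in the uniqueness class with zero initial value vanishes. -/
lemma IsL2HeatSolution.eq_zero (hq0 : 0 < q) (hq1 : q < 1) (hν0 : 0 ≤ ν) {f : ℝ → 𝕜}
    {u : ℝ → ℝ → 𝕜} (hu : IsL2HeatSolution q ν f u) (hf : ∀ x ∈ Rq q, f x = 0) {T : ℝ}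
    (hT : 0 ≤ T) {x : ℝ} (hx : x ∈ Rq q) : u T x = 0 := by
  rcases hT.eq_or_lt with rfl | hT
  · rw [hu.initial x hx, hf x hx]
  obtain ⟨n₀, rfl⟩ := hx
  obtain ⟨hp0, hp1⟩ := pow_two_pos_lt hq0 hq1
  have ha0 : 0 < q ^ (2 * ν + 2) := Real.rpow_pos_of_pos hq0 _
  have hS : ∀ t, 0 ≤ t → SqSummable q ν (latticeSeq q (u t)) := fun t ht =>
    (memL_two_iff hq0 _).1 (hu.mem t ht)
  obtain ⟨B, hB⟩ := hu.exists_sqNorm_le hq0 hq1 T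
  have hv : ∀ t, 0 ≤ t → ∀ n : ℤ, HasDerivWithinAt (fun r => latticeSeq q (u r) n)
      ((1 / (q ^ n) ^ 2) • (latticeSeq q (u t) (n - 1) - (1 + q ^ (2 * ν)) • latticeSeq q (u t) n +
        q ^ (2 * ν) • latticeSeq q (u t) (n + 1))) (Set.Ici 0) t := by
    intro t ht n
    rw [← qLaplacian_zpow hq0]
    exact hu.equation t ht _ ⟨n, rfl⟩
  have hstep : ∀ s ∈ Set.Ioc 0 T, (q ^ (2 * ν + 2)) ^ n₀ * ‖latticeSeq q (u T) n₀‖ ^ 2 ≤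
      sqNorm q ν (latticeSeq q (u s)) := by
    intro s hs
    obtain ⟨C, hC⟩ := hu.bounded s T hs.1 hs.2
    have hmain := weight_mul_norm_sq_le hq0 hq1 hν0 hs.1.le hs.2 hv (K := C ^ 2) (B := B)
      (N := sqNorm q ν (latticeSeq q (u s)))
      (fun t ht n => by
        have := hC t ht (q ^ n) ⟨n, rfl⟩
        rw [latticeSeq]
        gcongr)
      (fun t ht n => ((hS t (hs.1.le.trans ht.1)).le_sqNorm hq0 n).trans
        (hB t ⟨hs.1.le.trans ht.1, ht.2⟩))
      (fun F => (hS s hs.1.le).sum_le_tsum F fun _ _ => by positivity) n₀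
    -- After division by `M`, both boundary terms vanish as `M → ∞`. The bound `C` depends on `s`,
    -- which is harmless because `s → 0` is taken only afterwards.
    have hlim : Tendsto (fun M : ℕ => sqNorm q ν (latticeSeq q (u s)) +
        ((q ^ (2 * ν)) ^ n₀ * C ^ 2 / M + q ^ (2 * ν + 2) * (q ^ 2) ^ (-n₀) * (q ^ 2) ^ M * B) *
          (T - s)) atTop (𝓝 (sqNorm q ν (latticeSeq q (u s)) +
        (0 + q ^ (2 * ν + 2) * (q ^ 2) ^ (-n₀) * 0 * B) * (T - s))) := by
      refine tendsto_const_nhds.add (((tendsto_const_div_atTop_nhds_zero_nat _).add ?_).mul_const _)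
      exact ((tendsto_pow_atTop_nhds_zero_of_lt_one hp0.le hp1).const_mul _).mul_const _
    simp only [mul_zero, zero_mul, add_zero] at hlim
    refine ge_of_tendsto hlim ?_
    filter_upwards [eventually_gt_atTop 0] with M hM
    have hM' : (0 : ℝ) < M := by exact_mod_cast hM
    rw [← mul_le_mul_iff_right₀ hM']
    refine (hmain M).trans (le_of_eq ?_)
    field_simp
  have h0 : latticeSeq q (u 0) = 0 := by
    ext n
    rw [latticeSeq, hu.initial _ ⟨n, rfl⟩, hf _ ⟨n, rfl⟩]
    rfl
  have hlim := (tendsto_normL_two_iff hq0 hq1 _).1 (hu.continuous 0 le_rfl)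
  have hlim2 : Tendsto (fun s => sqNorm q ν (latticeSeq q (u s))) (𝓝[>] 0) (𝓝 0) := by
    refine (hlim.mono_left (nhdsWithin_mono 0 Set.Ioi_subset_Ici_self)).congr fun s => ?_
    congr 1
    ext n
    have := congrFun h0 n
    simp only [latticeSeq, Pi.zero_apply] at this ⊢
    rw [this, sub_zero]
  have h1 := ge_of_tendsto hlim2 (by
    filter_upwards [Ioc_mem_nhdsGT hT] with s hs using hstep s hs)
  have h2 : ‖latticeSeq q (u T) n₀‖ ^ 2 ≤ 0 := by
    by_contra h
    push Not at h
    have := mul_pos (zpow_pos ha0 n₀) h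
    linarith
  exact norm_eq_zero.1 (pow_eq_zero_iff two_ne_zero |>.1 (le_antisymm h2 (sq_nonneg _)))

end

/-! ### Non-uniqueness for negative order -/

section

variable {E : Type*} [NormedAddCommGroup E] [NormedSpace ℝ E] {q ν : ℝ}

lemma IsL2HeatSolution.congr_initial {f g : ℝ → E} {u : ℝ → ℝ → E}
    (hu : IsL2HeatSolution q ν f u) (h : ∀ x ∈ Rq q, f x = g x) : IsL2HeatSolution q ν g u :=
  ⟨⟨fun x hx => (hu.initial x hx).trans (h x hx), hu.equation⟩, hu.mem, hu.continuous, hu.bounded⟩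

lemma weight_mul_norm_rpow_smul (hq0 : 0 < q) (f : ℝ → E) (n : ℤ) :
    (q ^ (2 * ν + 2)) ^ n * ‖latticeSeq q (fun x => x ^ (-(2 * ν)) • f x) n‖ ^ 2 =
      (q ^ (2 * -ν + 2)) ^ n * ‖latticeSeq q f n‖ ^ 2 := by
  have hx : 0 < q ^ n := by positivity
  have h : ∀ μ : ℝ, (q ^ μ) ^ n = (q ^ n) ^ μ := fun μ => by
    rw [← Real.rpow_intCast, ← Real.rpow_intCast, ← Real.rpow_mul hq0.le, ← Real.rpow_mul hq0.le,
      mul_comm]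
  simp only [latticeSeq]
  rw [norm_smul, Real.norm_of_nonneg (by positivity), mul_pow, ← mul_assoc, h, h,
    ← Real.rpow_natCast, ← Real.rpow_mul hx.le, ← Real.rpow_add hx]
  congr 2
  push_cast
  ring

lemma sqSummable_rpow_smul_iff (hq0 : 0 < q) (f : ℝ → E) :
    SqSummable q ν (latticeSeq q fun x => x ^ (-(2 * ν)) • f x) ↔
      SqSummable q (-ν) (latticeSeq q f) :=
  summable_congr (weight_mul_norm_rpow_smul hq0 f)

lemma sqNorm_rpow_smul (hq0 : 0 < q) (f : ℝ → E) :
    sqNorm q ν (latticeSeq q fun x => x ^ (-(2 * ν)) • f x) = sqNorm q (-ν) (latticeSeq q f) :=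
  tsum_congr (weight_mul_norm_rpow_smul hq0 f)

/-- Conjugation by `x ^ (-2ν)` exchanges the coefficients of the two neighbours up to the factor `q
^ (2ν)`, which the change of time scale absorbs. -/
lemma qLaplacian_rpow_smul (hq0 : 0 < q) (f : ℝ → E) {x : ℝ} (hx : 0 < x) :
    qLaplacian q ν (fun x => x ^ (-(2 * ν)) • f x) x =
      (x ^ (-(2 * ν)) * q ^ (2 * ν)) • qLaplacian q (-ν) f x := by
  have h1 : (q⁻¹ * x) ^ (-(2 * ν)) = q ^ (2 * ν) * x ^ (-(2 * ν)) := by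
    rw [Real.mul_rpow (by positivity) hx.le, Real.inv_rpow hq0.le, Real.rpow_neg hq0.le, inv_inv]
  have h2 : q ^ (2 * ν) * (q * x) ^ (-(2 * ν)) = x ^ (-(2 * ν)) := by
    rw [Real.mul_rpow hq0.le hx.le, ← mul_assoc, ← Real.rpow_add hq0, add_neg_cancel,
      Real.rpow_zero, one_mul]
  have h3 : q ^ (2 * ν) * q ^ (2 * -ν) = 1 := by
    rw [← Real.rpow_add hq0, mul_neg, add_neg_cancel, Real.rpow_zero]
  simp only [qLaplacian]
  rw [smul_smul (q ^ (2 * ν)), h1, h2]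
  match_scalars
  · ring
  · linear_combination 1 / x ^ 2 * x ^ (-(2 * ν)) * h3
  · linear_combination -(1 / x ^ 2 * x ^ (-(2 * ν))) * h3

/-- A solution of order `-ν ∈ (0, 1)` gives a solution of order `ν`. -/
lemma IsL2HeatSolution.rpow_smul (hq0 : 0 < q) (hq1 : q < 1) (hν : -1 < ν) (hν0 : ν < 0)
    {f : ℝ → E} {v : ℝ → ℝ → E} (hv : IsL2HeatSolution q (-ν) f v) :
    IsL2HeatSolution q ν (fun x => x ^ (-(2 * ν)) • f x)
      fun t x => x ^ (-(2 * ν)) • v (q ^ (2 * ν) * t) x := by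
  obtain ⟨ha0, ha1⟩ := weight_mem hq0 hq1 hν
  have hβ : 0 < q ^ (2 * ν) := Real.rpow_pos_of_pos hq0 _
  refine ⟨⟨fun x hx => ?_, ?_⟩, fun t ht => ?_, fun t ht => ?_, fun a b ha hab => ?_⟩
  · rw [mul_zero, hv.initial x hx]
  · rintro t ht _ ⟨m, rfl⟩
    have h1 := hv.equation (q ^ (2 * ν) * t) (by positivity) _ ⟨m, rfl⟩
    have h2 : HasDerivWithinAt (fun s => q ^ (2 * ν) * s) (q ^ (2 * ν)) (Set.Ici 0) t := by
      simpa using ((hasDerivAt_id t).const_mul (q ^ (2 * ν))).hasDerivWithinAt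
    have h3 := (h1.scomp t h2 fun s hs => mul_nonneg hβ.le hs).const_smul ((q ^ m) ^ (-(2 * ν)))
    refine h3.congr_deriv ?_
    rw [qLaplacian_rpow_smul hq0 _ (by positivity), smul_smul]
  · rw [memL_two_iff hq0, sqSummable_rpow_smul_iff hq0, ← memL_two_iff hq0]
    exact hv.mem _ (by positivity)
  · rw [tendsto_normL_two_iff hq0 hq1]
    simp only [← smul_sub, sqNorm_rpow_smul hq0 fun x => v (q ^ (2 * ν) * _) x - v _ x]
    have h1 := (tendsto_normL_two_iff hq0 hq1 _).1
      (hv.continuous (q ^ (2 * ν) * t) (by positivity))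
    refine h1.comp (tendsto_nhdsWithin_iff.2 ⟨?_, ?_⟩)
    · exact (Continuous.tendsto (by fun_prop) t).mono_left nhdsWithin_le_nhds
    · filter_upwards [self_mem_nhdsWithin] with s hs using mul_nonneg hβ.le hs
  · obtain ⟨C, hC⟩ := hv.bounded (q ^ (2 * ν) * a) (q ^ (2 * ν) * b) (by positivity) (by gcongr)
    obtain ⟨B, hB⟩ := hv.exists_sqNorm_le hq0 hq1 (q ^ (2 * ν) * b)
    refine ⟨max C √B, ?_⟩
    rintro t ht _ ⟨m, rfl⟩
    have ht0 : 0 ≤ t := ha.le.trans ht.1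
    have htb : q ^ (2 * ν) * t ≤ q ^ (2 * ν) * b := by gcongr; exact ht.2
    have hta : q ^ (2 * ν) * a ≤ q ^ (2 * ν) * t := by gcongr; exact ht.1
    -- Near the origin `x ^ (-2ν) ≤ 1` since `ν < 0`. Far out this factor is unbounded, but there `a
    -- ^ m ≥ 1`, so the norm controls pointwise values.
    rcases le_total 0 m with hm | hm
    · refine le_trans ?_ (le_max_left _ _)
      have h1 : (q ^ m) ^ (-(2 * ν)) ≤ 1 :=
        Real.rpow_le_one (by positivity) (zpow_le_one₀ hq0 hq1.le hm) (by linarith)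
      rw [norm_smul, Real.norm_of_nonneg (by positivity)]
      exact (mul_le_of_le_one_left (norm_nonneg _) h1).trans (hC _ ⟨hta, htb⟩ _ ⟨m, rfl⟩)
    · refine le_trans ?_ (le_max_right _ _)
      refine Real.le_sqrt_of_sq_le ?_
      have hS := (memL_two_iff hq0 _).1 (hv.mem (q ^ (2 * ν) * t) (by positivity))
      have h1 := (hS.le_sqNorm hq0 m).trans (hB _ ⟨by positivity, htb⟩)
      rw [← weight_mul_norm_rpow_smul hq0] at h1
      exact (le_mul_of_one_le_left (sq_nonneg _)
        (one_le_zpow_of_nonpos₀ ha0 ha1.le hm)).trans h1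

end

/-! ### Behaviour at the origin and the second solution -/

section

variable {q ν : ℝ}

lemma tendsto_besselSeq (hq0 : 0 < q) (hq1 : q < 1) (hν : -1 < ν) :
    Tendsto (besselSeq q ν) atTop (𝓝 1) := by
  obtain ⟨hp0, hp1⟩ := pow_two_pos_lt hq0 hq1
  rw [← Nat.map_cast_int_atTop, tendsto_map'_iff]
  have h := tendsto_powerSeries_mul_pow hp0 hp1 (x := 1) (c := besselTerm q ν 1)
    (by simpa using summable_besselTerm hq0 hq1 hν 1)
  have h0 : besselTerm q ν 1 0 = 1 := by simp [besselTerm, qPoch_zero]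
  rw [h0] at h
  refine h.congr fun n => ?_
  rw [Function.comp, besselSeq, besselJ_eq_tsum]
  refine tsum_congr fun k => ?_
  rw [zpow_natCast, one_mul, ← pow_mul, ← pow_mul]
  conv_rhs => rw [← one_mul (q ^ n), besselTerm_mul, ← pow_mul]
  congr 2
  ring

/-- The norm of `P_1 ρ_1` has a positive limit at the origin. -/
lemma heatSemigroup_rho_tendsto {𝕜 : Type*} [RCLike 𝕜] (hq0 : 0 < q) (hq1 : q < 1) (hν : -1 < ν) :
    ∃ c : ℝ, 0 < c ∧ Tendsto (fun m : ℤ => ‖heatSemigroup q ν 1 (rho 𝕜 q ν 1) (q ^ m)‖) atTop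
      (𝓝 c) := by
  obtain ⟨ha0, ha1⟩ := weight_mem hq0 hq1 hν
  have hκ := fourierConst_pos hq0 hq1 hν
  obtain ⟨B, hB0, hB⟩ := exists_abs_besselSeq_le_one hq0 hq1 hν
  set w : ℤ → ℝ := fun k => fourierConst q ν * ((q ^ (2 * ν + 2)) ^ k *
    Real.exp (-2 * (q ^ k) ^ 2)) with hw
  have hw0 : ∀ k, 0 < w k := fun k => by positivity
  have hws : Summable w := (summable_weight_mul_exp hq0 hq1 hν two_pos).mul_left _
  have hheat : ∀ m : ℤ, heatSemigroup q ν 1 (rho 𝕜 q ν 1) (q ^ m) =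
      ((∑' k, w k * besselSeq q ν (m + k) : ℝ) : 𝕜) := by
    intro m
    have h1 := congrFun (latticeSeq_heatSemigroup hq0 hq1 hν zero_le_one
      ((memL_rho (𝕜 := 𝕜) hq0 hq1 hν one_pos).tempered hq0 hq1 hν one_le_two)) m
    rw [latticeSeq] at h1
    rw [h1, heatSeq, hankel_rho hq0 hq1 hν one_pos, hankel, RCLike.ofReal_tsum]
    refine tsum_congr fun k => ?_
    rw [smul_smul, latticeSeq, gaussian, RCLike.real_smul_eq_coe_mul, ← RCLike.ofReal_mul]
    congr 1
    have h2 : Real.exp (-2 * (q ^ k) ^ 2) =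
        Real.exp (-1 * (q ^ k) ^ 2) * Real.exp (-1 * (q ^ k) ^ 2) := by
      rw [← Real.exp_add]; ring_nf
    simp only [hw, h2]
    ring
  have hlim : Tendsto (fun m : ℤ => ∑' k, w k * besselSeq q ν (m + k)) atTop (𝓝 (∑' k, w k)) := by
    refine tendsto_tsum_of_dominated_convergence (hws.mul_right B) (fun k => ?_)
      (Eventually.of_forall fun m k => ?_)
    · simpa using ((tendsto_besselSeq hq0 hq1 hν).comp
        (tendsto_atTop_add_const_right atTop k tendsto_id)).const_mul (w k)
    · rw [norm_mul, Real.norm_of_nonneg (hw0 k).le]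
      exact mul_le_mul_of_nonneg_left (hB _) (hw0 k).le
  have hpos : 0 < ∑' k, w k := hws.tsum_pos (fun k => (hw0 k).le) 0 (hw0 0)
  refine ⟨∑' k, w k, hpos, ?_⟩
  simp only [hheat, RCLike.norm_ofReal]
  simpa [abs_of_pos hpos] using hlim.abs

/-- For `ν < 0` the initial value `ρ_1` has a second solution in the uniqueness class. -/
lemma exists_isL2HeatSolution_ne {𝕜 : Type*} [RCLike 𝕜] (hq0 : 0 < q) (hq1 : q < 1)
    (hν : -1 < ν) (hν0 : ν < 0) :
    ∃ u, IsL2HeatSolution q ν (rho 𝕜 q ν 1) u ∧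
      ∃ x ∈ Rq q, u 1 x ≠ heatSemigroup q ν 1 (rho 𝕜 q ν 1) x := by
  have hβ : 0 < q ^ (2 * ν) := Real.rpow_pos_of_pos hq0 _
  set f₀ := rho 𝕜 q ν 1
  set g : ℝ → 𝕜 := fun x => x ^ (2 * ν) • f₀ x with hg
  have hfg : ∀ x ∈ Rq q, x ^ (-(2 * ν)) • g x = f₀ x := by
    rintro _ ⟨m, rfl⟩
    have hx : 0 < q ^ m := by positivity
    simp only [hg]
    rw [smul_smul, ← Real.rpow_add hx, neg_add_cancel, Real.rpow_zero, one_smul]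
  have hgL : MemL q 2 (-ν) g := by
    rw [memL_two_iff hq0, ← sqSummable_rpow_smul_iff hq0]
    convert (memL_two_iff hq0 _).1 (memL_rho (𝕜 := 𝕜) hq0 hq1 hν one_pos) using 1
    ext n
    exact hfg _ ⟨n, rfl⟩
  have hv := isL2HeatSolution_heatSemigroup hq0 hq1 (by linarith : -1 < -ν) hgL
  refine ⟨_, (hv.rpow_smul hq0 hq1 hν hν0).congr_initial hfg, ?_⟩
  by_contra! h
  obtain ⟨c, hc0, hc⟩ := heatSemigroup_rho_tendsto (𝕜 := 𝕜) hq0 hq1 hν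
  obtain ⟨C, hC⟩ := hv.bounded (q ^ (2 * ν) * 1) (q ^ (2 * ν) * 1) (by positivity) le_rfl
  -- The second solution at `q ^ n` and time `1` is at most `(q ^ (-2ν)) ^ n C` in norm, so
  -- agreement with `P_1 ρ_1` would force the limit `c` to be nonpositive.
  have hlim : Tendsto (fun n : ℕ => (q ^ (-(2 * ν))) ^ n * C) atTop (𝓝 (0 * C)) :=
    (tendsto_pow_atTop_nhds_zero_of_lt_one (by positivity)
      (Real.rpow_lt_one hq0.le hq1 (by linarith))).mul_const C
  have hc' := hc.comp tendsto_natCast_atTop_atTop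
  have h1 := le_of_tendsto_of_tendsto' hc' hlim fun n => by
    simp only [Function.comp]
    rw [← h _ ⟨n, rfl⟩, norm_smul, Real.norm_of_nonneg (by positivity)]
    have h2 : (q ^ (n : ℤ)) ^ (-(2 * ν)) = (q ^ (-(2 * ν))) ^ n := by
      rw [zpow_natCast, ← Real.rpow_natCast, ← Real.rpow_natCast, ← Real.rpow_mul hq0.le,
        ← Real.rpow_mul hq0.le, mul_comm]
    rw [h2]
    gcongr
    exact hC _ ⟨le_rfl, le_rfl⟩ _ ⟨n, rfl⟩
  linarith

end

end

end QBessel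

theorem theorem1 {𝕜 : Type*} [RCLike 𝕜] (q ν : ℝ) (hq0 : 0 < q) (hq1 : q < 1) (hν : -1 < ν) :
    -- existence for data in `𝓛_{q,p,ν}`
    (∀ p : ℝ, 1 ≤ p → ∀ f : ℝ → 𝕜, MemL q p ν f →
      -- the series defining `P_t f` converge
      (∀ t, 0 ≤ t → ∀ x ∈ Rq q,
        (∀ y ∈ Rq q, JacksonIntegrable q (heatKernelIntegrand q ν t x y)) ∧
        JacksonIntegrable q (heatSemigroupIntegrand q ν t f x)) ∧
      -- `P_t f = ρ_t *_q f`, with convergence of all series involved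
      (∀ t, 0 < t →
        FourierDefined q ν (gaussian 𝕜 t) ∧ QConvDefined q ν (rho 𝕜 q ν t) f ∧
        ∀ x ∈ Rq q, heatSemigroup q ν t f x = qConv q ν (rho 𝕜 q ν t) f x) ∧
      -- `P_t f` solves the `q`-heat equation with initial value `f`
      IsHeatSolution q ν f (fun t => heatSemigroup q ν t f)) ∧
    -- uniqueness for data in `𝓛_{q,2,ν}` holds exactly when `ν ≥ 0`
    (∀ f : ℝ → 𝕜, MemL q 2 ν f →
      IsL2HeatSolution q ν f (fun t => heatSemigroup q ν t f) ∧
      ((∀ u : ℝ → ℝ → 𝕜, IsL2HeatSolution q ν f u →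
          ∀ t, 0 ≤ t → ∀ x ∈ Rq q, u t x = heatSemigroup q ν t f x) ↔ 0 ≤ ν)) := by

  refine ⟨fun p hp f hf => ?_, fun f hf => ⟨isL2HeatSolution_heatSemigroup hq0 hq1 hν hf, ?_, ?_⟩⟩
  · have hT := hf.tempered hq0 hq1 hν hp
    exact ⟨fun t ht x hx => ⟨fun y hy => jacksonIntegrable_heatKernelIntegrand hq0 hq1 hν ht hx hy,
        jacksonIntegrable_heatSemigroupIntegrand hq0 hq1 hν ht hT hx⟩,
      fun t ht => ⟨fourierDefined_of_tempered hq0 hq1 hν (tempered_gaussian hq0 hq1 hν ht),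
        qConvDefined_rho hq0 hq1 hν ht hT,
        fun x hx => heatSemigroup_eq_qConv hq0 hq1 hν ht hT hx⟩,
      isHeatSolution_heatSemigroup hq0 hq1 hν hT⟩
  · intro huniq
    by_contra! hν0
    obtain ⟨w, hw, x, hx, hne⟩ := exists_isL2HeatSolution_ne (𝕜 := 𝕜) hq0 hq1 hν hν0
    have hf₀ := isL2HeatSolution_heatSemigroup hq0 hq1 hν (memL_rho (𝕜 := 𝕜) hq0 hq1 hν one_pos)
    -- The difference of the two solutions with datum `ρ_1` has zero initial value, so subtracting
    -- it from `P_t f` gives another solution with datum `f`.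
    have hu := (isL2HeatSolution_heatSemigroup hq0 hq1 hν hf).sub hq0 hq1 (hf₀.sub hq0 hq1 hw)
    have h := huniq _ (hu.congr_initial fun x _ => by simp) 1 zero_le_one x hx
    rw [sub_eq_self, sub_eq_zero] at h
    exact hne h.symm
  · intro hν0 u hu t ht x hx
    have h := hu.sub hq0 hq1 (isL2HeatSolution_heatSemigroup hq0 hq1 hν hf)
    exact sub_eq_zero.1 (h.eq_zero hq0 hq1 hν0 (fun x _ => sub_self _) ht hx)
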